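/- \textbf{Theorem.} Let $n,p\ge 1$. For a tensor $\mathscr A=[a_{ijk}]\in\mathbb C^{m\times n\times p}$ with frontal slices $A^{(1)},\dots,A^{(p)}\in\mathbb C^{m\times n}$, let $\operatorname{bcirc}(\mathscr A)\in\mathbb C^{mp\times np}$ be the block-circulant matrix whose $(k,l)$ block is $A^{(((k-l)\bmod p)+1)}$, let $\operatorname{unfold}(\mathscr A)\in\mathbb C^{mp\times n}$ be the matrix obtained by stacking the frontal slices, and let $\operatorname{fold}$ be its inverse. The T-product of conforming tensors is $\mathscr A*\mathscr B=\operatorname{fold}(\operatorname{bcirc}(\mathscr A)\operatorname{unfold}(\mathscr B))$. The identity tensor $\mathscr I\in\mathbb C^{n\times n\times p}$ has first frontal slice $I_n$ and all others $0$; $\mathscr A^{-1}$ denotes the tensor with $\mathscr A*\mathscr A^{-1}=\mathscr A^{-1}*\mathscr A=\mathscr I$, if it exists. Let $\langle\mathscr X,\mathscr Y\rangle_F=\sum_{i,j,k}\overline{x_{ijk}}\,y_{ijk}$ and $\|\mathscr X\|_F=\sqrt{\langle\mathscr X,\mathscr X\rangle_F}$. A tensor $\mathscr A\in\mathbb C^{n\times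 n\times p}$ is \emph{sectorial} if $\langle\mathscr X,\mathscr A*\mathscr X\rangle_F\neq 0$ for all $\mathscr X\in\mathbb C^{n\times1\times p}$ with $\|\mathscr X\|_F=1$, and the set of \emph{strictly accretive} tensors is $$\mathbb T_+^{n\times n\times p}=\{\mathscr A\in\mathbb C^{n\times n\times p}:\ \operatorname{Re}\langle\mathscr X,\mathscr A*\mathscr X\rangle_F>0\ \text{ for all nonzero }\mathscr X\in\mathbb C^{n\times1\times p}\}.$$ A \emph{canonical T-phase vector} of a sectorial tensor $\mathscr A$ is a vector $\phi(\mathscr A)=(\phi_1,\dots,\phi_{np})$ with $\phi_k\in(-\pi,\pi]$, $\phi_1\ge\dots\ge\phi_{np}$ and $\phi_1-\phi_{np}<\pi$, such that $\operatorname{bcirc}(\mathscr A)=T^HDT$ for some nonsingular $T\in\mathbb C^{np\times np}$ and $D=\operatorname{diag}(e^{\mathrm i\phi_1},\dots,e^{\mathrm i\phi_{np}})$. Let $\mathscr A,\mathscr B\in\mathbb T_+^{n\times n\times p}$. Then the geometric mean $\mathscr A\#\mathscr B\in\mathbb C^{n\times n\times p}$ is well defined by $$(\mathscr A\#\mathscr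 B)^{-1}=\frac2\pi\int_0^\infty\left(t\mathscr A+t^{-1}\mathscr B\right)^{-1}\frac{dt}{t}$$ (the T-inverses under the integral exist for all $t>0$, the integral converges absolutely, and its value is T-invertible); the tensors $\mathscr A$, $\mathscr B$ and $\mathscr A\#\mathscr B$ are sectorial and each has exactly one canonical T-phase vector; and $$\phi(\mathscr A\#\mathscr B)\prec\tfrac12\phi(\mathscr A)+\tfrac12\phi(\mathscr B).$$ Here, for $x,y\in\mathbb R^{N}$, $x\prec y$ means (strong) majorization: for every $k\le N$ the sum of the $k$ largest entries of $x$ is at most that of $y$, and $\sum_i x_i=\sum_i y_i$. -/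

import Mathlib

noncomputable section

namespace TProduct

/-- Third-order complex tensors of size `m × n × p`; `A i j k` is the entry `a_{ijk}` and
`fun i j => A i j k` is the `k`-th frontal slice. -/
abbrev Tensor (m n p : ℕ) : Type := Fin m → Fin n → Fin p → ℂ

/-- The block-circulant embedding. Rows and columns are indexed by pairs
`(block index, index inside the block)`; block `(k, l)` is the frontal slice number `k - l`
modulo `p`. -/
def bcirc {m n p : ℕ} (A : Tensor m n p) : Matrix (Fin p × Fin m) (Fin p × Fin n) ℂ :=
  Matrix.of fun a b => A a.2 b.2 (a.1 - b.1)

/-- Stack the frontal slices on top of each other. -/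
def unfold {m n p : ℕ} (A : Tensor m n p) : Matrix (Fin p × Fin m) (Fin n) ℂ :=
  Matrix.of fun a j => A a.2 j a.1

/-- The inverse of `unfold`. -/
def fold {m n p : ℕ} (M : Matrix (Fin p × Fin m) (Fin n) ℂ) : Tensor m n p :=
  fun i j k => M (k, i) j

/-- The T-product. -/
def tProd {m n s p : ℕ} (A : Tensor m n p) (B : Tensor n s p) : Tensor m s p :=
  fold (bcirc A * unfold B)

/-- The identity tensor: the first frontal slice is the identity matrix, the others vanish. -/
def tId (n p : ℕ) : Tensor n n p :=
  fun i j k => if i = j ∧ (k : ℕ) = 0 then 1 else 0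

/-- `B` is a T-inverse of `A`. -/
def IsTInverse {n p : ℕ} (A B : Tensor n n p) : Prop :=
  tProd A B = tId n p ∧ tProd B A = tId n p

/-- T-invertibility. -/
def TInvertible {n p : ℕ} (A : Tensor n n p) : Prop := ∃ B, IsTInverse A B

open Classical in
/-- The T-inverse of a T-invertible tensor (and `0` if `A` is not T-invertible). -/
def tInv {n p : ℕ} (A : Tensor n n p) : Tensor n n p :=
  if h : TInvertible A then h.choose else 0

/-- The Frobenius inner product, conjugate-linear in the first argument. -/
def frobInner {m n p : ℕ} (X Y : Tensor m n p) : ℂ :=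
  ∑ i, ∑ j, ∑ k, starRingEnd ℂ (X i j k) * Y i j k

/-- The Frobenius norm. -/
def frobNorm {m n p : ℕ} (X : Tensor m n p) : ℝ := Real.sqrt (frobInner X X).re

/-- The numerical range of a frontal-square tensor. -/
def numericalRange {n p : ℕ} (A : Tensor n n p) : Set ℂ :=
  {z | ∃ X : Tensor n 1 p, frobNorm X = 1 ∧ frobInner X (tProd A X) = z}

/-- Sectorial tensors. -/
def IsSectorial {n p : ℕ} (A : Tensor n n p) : Prop := (0 : ℂ) ∉ numericalRange A

/-- The set `𝕋₊` of strictly accretive tensors. -/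
def strictlyAccretive (n p : ℕ) : Set (Tensor n n p) :=
  {A | ∀ X : Tensor n 1 p, X ≠ 0 → 0 < (frobInner X (tProd A X)).re}

/-- `φ` is a canonical T-phase vector of `A`: there is a sectorial decomposition
`bcirc A = Tᴴ D T` with `T` nonsingular and `D` the diagonal matrix of the numbers `e^{iφ_k}`,
where `φ` takes values in `(-π, π]`, is nonincreasing, and has spread smaller than `π`. The
bijection `finProdFinEquiv` numbers the rows of `bcirc A` from top to bottom. -/
structure IsCanonicalPhase {n p : ℕ} (A : Tensor n n p) (φ : Fin (p * n) → ℝ) : Prop where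
  mem_Ioc : ∀ k, φ k ∈ Set.Ioc (-Real.pi) Real.pi
  antitone : Antitone φ
  spread : ∀ k l, φ k - φ l < Real.pi
  decomposition : ∃ T : Matrix (Fin p × Fin n) (Fin p × Fin n) ℂ, IsUnit T ∧
    bcirc A = T.conjTranspose *
      Matrix.diagonal (fun a => Complex.exp (Complex.I * (φ (finProdFinEquiv a) : ℂ))) * T

/-- The canonical T-phase vector `φ(A)` (a vector satisfying `IsCanonicalPhase A`, if any). -/
def canonicalPhase {n p : ℕ} (A : Tensor n n p) : Fin (p * n) → ℝ :=
  Classical.epsilon (IsCanonicalPhase A)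

/-- The integrand `(tA + t⁻¹B)⁻¹ / t` of the integral defining the geometric mean. -/
def geomMeanIntegrand {n p : ℕ} (A B : Tensor n n p) (t : ℝ) : Tensor n n p :=
  t⁻¹ • tInv (t • A + t⁻¹ • B)

/-- The tensor `(2/π) ∫₀^∞ (tA + t⁻¹B)⁻¹ dt/t`, whose T-inverse is the geometric mean. -/
def geomMeanInv {n p : ℕ} (A B : Tensor n n p) : Tensor n n p :=
  (2 / Real.pi) • ∫ t in Set.Ioi (0 : ℝ), geomMeanIntegrand A B t

/-- The T-product geometric mean `A # B`. -/
def geomMean {n p : ℕ} (A B : Tensor n n p) : Tensor n n p := tInv (geomMeanInv A B)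

/-- The nonincreasing rearrangement of a real vector. -/
def decreasingRearrangement {N : ℕ} (x : Fin N → ℝ) : Fin N → ℝ := x ∘ Tuple.sort (-x)

/-- `Majorized x y` is (strong) majorization `x ≺ y`. -/
def Majorized {N : ℕ} (x y : Fin N → ℝ) : Prop :=
  (∀ k ≤ N, ∑ i : Fin N with i.val < k, decreasingRearrangement x i
      ≤ ∑ i : Fin N with i.val < k, decreasingRearrangement y i) ∧
    ∑ i, x i = ∑ i, y i

end TProduct

end

/-!
The block-circulant embedding `bcirc` is an injective algebra homomorphism whose image is closed
under inversion, so the statement reduces to strictly accretive matrices `M`, `N` with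
`G⁻¹ = (2/π) ∫ (tM + t⁻¹N)⁻¹ dt/t`.

*The mean.* With `t = tan θ` the integral becomes `J = (2/π) ∫₀^{π/2} (sin²θ M + cos²θ N)⁻¹ dθ`, an
integral of a continuous function over a compact interval, whose value is accretive because
inverses and convex combinations of accretive matrices are. Writing `M⁻¹N = 1 + E`, one has
`J = R(1) M⁻¹` with `R(s) = (2/π) ∫ (1 + s cos²θ E)⁻¹ dθ`. Integration by parts yields the
differential equation `2 (1 + sE) R' = -E R`, hence `R(s)² (1 + sE)` is constant
(`invSqrtIntegral_sq`), and `J N J = M⁻¹`. So `G = J⁻¹` satisfies `G M⁻¹ G = N`.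

*Phases.* An accretive matrix `H + iK` is congruent to `1 + iΛ` with `Λ` real diagonal, which gives
phases in `(-π/2, π/2)`; they are unique since `M⁻¹ Mᴴ` has the eigenvalues `e^{-2iφ}`. On the convex
set of accretive matrices the argument of the determinant has a continuous branch `argDet` vanishing
at `1`, and `argDet M` is the sum of the phases (`HasPhases.argDet_eq`).

*Majorization.* After a congruence `G` is `D = diag(e^{iγ})`, and `G M⁻¹ G = N` reads `N = D P D` with
`Pᴴ` congruent to `M`. For the leading `k × k` blocks `argDet N_k + argDet Pᴴ_k = 2 (γ₁ + ⋯ + γ_k)`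
(`argDet_submatrix_diagonal_congruence`): both sides agree modulo `2π`, and the convex set of `P` such
that `P` and `D P D` are accretive contains `D⁻¹`, where they are equal. Interlacing of phases under
compression (`HasPhases.compression_le`) bounds the left side by the sums of the `k` largest phases
of `N` and `M`, with equality when `k` is the full size.
-/

/-! ### The inverse square root as an integral over a quarter circle -/

namespace TProduct

open MeasureTheory Set

section InverseSqrt

variable {𝔸 : Type*} [NormedRing 𝔸] [NormedAlgebra ℝ 𝔸]

/-- `R(s) = (2/π) ∫₀^{π/2} (1 + s cos²θ E)⁻¹ dθ`, which turns out to be `(1 + sE)^{-1/2}`. -/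
noncomputable def invSqrtIntegral (E : 𝔸) (s : ℝ) : 𝔸 :=
  (2 / Real.pi) • ∫ θ in (0 : ℝ)..Real.pi / 2, Ring.inverse (1 + (s * Real.cos θ ^ 2) • E)

theorem hasDerivAt_ringInverse_one_add_smul [CompleteSpace 𝔸] (E : 𝔸) {c : ℝ} (hc : IsUnit (1 + c • E)) :
    HasDerivAt (fun c : ℝ => Ring.inverse (1 + c • E))
      (-(Ring.inverse (1 + c • E) * E * Ring.inverse (1 + c • E))) c := by
  obtain ⟨u, hu⟩ := hc
  have h1 : HasDerivAt (fun c : ℝ => 1 + c • E) E c := by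
    simpa using ((hasDerivAt_id c).smul_const E).const_add 1
  have h2 := hasFDerivAt_ringInverse (𝕜 := ℝ) u
  rw [hu] at h2
  have h3 := h2.comp_hasDerivAt c h1
  rw [← hu, Ring.inverse_unit]
  simpa [Function.comp_def] using h3

theorem commute_ringInverse_one_add_smul (E : 𝔸) (c : ℝ) :
    Commute E (Ring.inverse (1 + c • E)) := by
  have h : Commute E (1 + c • E) :=
    (Commute.one_right E).add_right ((Commute.refl E).smul_right c)
  by_cases hu : IsUnit (1 + c • E)
  · obtain ⟨u, hu⟩ := hu
    rw [← hu] at h ⊢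
    rw [Ring.inverse_unit]
    exact h.units_inv_right
  · rw [Ring.inverse_non_unit _ hu]
    exact Commute.zero_right E

theorem commute_ringInverse_ringInverse (E : 𝔸) (c d : ℝ) :
    Commute (Ring.inverse (1 + c • E)) (Ring.inverse (1 + d • E)) := by
  have h : Commute (Ring.inverse (1 + c • E)) (1 + d • E) :=
    (Commute.one_right _).add_right ((commute_ringInverse_one_add_smul E c).symm.smul_right d)
  by_cases hu : IsUnit (1 + d • E)
  · obtain ⟨u, hu⟩ := hu
    rw [← hu] at h ⊢
    rw [Ring.inverse_unit]
    exact h.units_inv_right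
  · rw [Ring.inverse_non_unit _ hu]
    exact Commute.zero_right _

variable [CompleteSpace 𝔸]

theorem mul_cos_sq_mem_Icc {s : ℝ} (hs : s ∈ Icc (0 : ℝ) 1) (θ : ℝ) :
    s * Real.cos θ ^ 2 ∈ Icc (0 : ℝ) 1 :=
  ⟨mul_nonneg hs.1 (sq_nonneg _),
    mul_le_one₀ hs.2 (sq_nonneg _) (Real.cos_sq_le_one θ)⟩

theorem commute_intervalIntegral {x : 𝔸} {f : ℝ → 𝔸} {a b : ℝ}
    (hf : IntervalIntegrable f volume a b) (h : ∀ θ, Commute x (f θ)) :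
    Commute x (∫ θ in a..b, f θ) := by
  have h1 := (ContinuousLinearMap.mul ℝ 𝔸 x).intervalIntegral_comp_comm hf
  have h2 := ((ContinuousLinearMap.mul ℝ 𝔸).flip x).intervalIntegral_comp_comm hf
  simp only [ContinuousLinearMap.mul_apply', ContinuousLinearMap.flip_apply] at h1 h2
  rw [Commute, SemiconjBy, ← h1, ← h2]
  exact intervalIntegral.integral_congr fun θ _ => h θ

variable {E : 𝔸}

theorem continuousOn_ringInverse_one_add_smul (hE : ∀ c ∈ Icc (0 : ℝ) 1, IsUnit (1 + c • E)) :
    ContinuousOn (fun c : ℝ => Ring.inverse (1 + c • E)) (Icc 0 1) := fun c hc =>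
  (hasDerivAt_ringInverse_one_add_smul E (hE c hc)).continuousAt.continuousWithinAt

theorem continuous_invSqrt_integrand (hE : ∀ c ∈ Icc (0 : ℝ) 1, IsUnit (1 + c • E))
    {s : ℝ} (hs : s ∈ Icc (0 : ℝ) 1) :
    Continuous fun θ : ℝ => Ring.inverse (1 + (s * Real.cos θ ^ 2) • E) :=
  (continuousOn_ringInverse_one_add_smul hE).comp_continuous (f := fun θ => s * Real.cos θ ^ 2)
    (by fun_prop) (mul_cos_sq_mem_Icc hs)

theorem exists_bound_ringInverse_one_add_smul (hE : ∀ c ∈ Icc (0 : ℝ) 1, IsUnit (1 + c • E)) :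
    ∃ C : ℝ, ∀ c ∈ Icc (0 : ℝ) 1, ‖Ring.inverse (1 + c • E)‖ ≤ C :=
  isCompact_Icc.exists_bound_of_continuousOn (continuousOn_ringInverse_one_add_smul hE)

theorem continuousOn_invSqrtIntegral (hE : ∀ c ∈ Icc (0 : ℝ) 1, IsUnit (1 + c • E)) :
    ContinuousOn (invSqrtIntegral E) (Icc 0 1) := by
  obtain ⟨C, hC⟩ := exists_bound_ringInverse_one_add_smul hE
  refine ContinuousOn.const_smul (fun s hs => ?_) _
  refine intervalIntegral.continuousWithinAt_of_dominated_interval (bound := fun _ => C)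
    ?_ ?_ (by simp) ?_
  · filter_upwards [self_mem_nhdsWithin] with s hs
    exact (continuous_invSqrt_integrand hE hs).aestronglyMeasurable
  · filter_upwards [self_mem_nhdsWithin] with s hs
    exact Filter.Eventually.of_forall fun θ _ => hC _ (mul_cos_sq_mem_Icc hs θ)
  · refine Filter.Eventually.of_forall fun θ _ => ?_
    exact (continuousOn_ringInverse_one_add_smul hE).comp (f := fun s : ℝ => s * Real.cos θ ^ 2)
      (by fun_prop) (fun s hs => mul_cos_sq_mem_Icc hs θ) s hs

theorem commute_invSqrtIntegral (hE : ∀ c ∈ Icc (0 : ℝ) 1, IsUnit (1 + c • E))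
    {s : ℝ} (hs : s ∈ Icc (0 : ℝ) 1) {x : 𝔸}
    (hx : ∀ c : ℝ, Commute x (Ring.inverse (1 + c • E))) : Commute x (invSqrtIntegral E s) :=
  (commute_intervalIntegral ((continuous_invSqrt_integrand hE hs).intervalIntegrable _ _)
    fun _ => hx _).smul_right _

theorem hasDerivAt_invSqrtIntegral (hE : ∀ c ∈ Icc (0 : ℝ) 1, IsUnit (1 + c • E))
    {s : ℝ} (hs : s ∈ Ioo (0 : ℝ) 1) :
    HasDerivAt (invSqrtIntegral E) ((2 / Real.pi) • ∫ θ in (0 : ℝ)..Real.pi / 2,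
      (Real.cos θ ^ 2) • (-(Ring.inverse (1 + (s * Real.cos θ ^ 2) • E) * E *
        Ring.inverse (1 + (s * Real.cos θ ^ 2) • E)))) s := by
  obtain ⟨C, hC⟩ := exists_bound_ringInverse_one_add_smul hE
  have hC0 : 0 ≤ C := (norm_nonneg _).trans (hC 0 (by simp))
  have hsub : ∀ s ∈ Ioo (0 : ℝ) 1, s ∈ Icc (0 : ℝ) 1 := fun s hs => Ioo_subset_Icc_self hs
  have hnhds : Ioo (0 : ℝ) 1 ∈ nhds s := isOpen_Ioo.mem_nhds hs
  have hcont := continuous_invSqrt_integrand hE (hsub s hs)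
  refine HasDerivAt.const_smul (2 / Real.pi) (intervalIntegral.hasDerivAt_integral_of_dominated_loc_of_deriv_le
    (F := fun s θ => Ring.inverse (1 + (s * Real.cos θ ^ 2) • E))
    (F' := fun s θ => (Real.cos θ ^ 2) • (-(Ring.inverse (1 + (s * Real.cos θ ^ 2) • E) * E *
        Ring.inverse (1 + (s * Real.cos θ ^ 2) • E))))
    (bound := fun _ => C * ‖E‖ * C) hnhds ?_ ?_ ?_ ?_
    (intervalIntegrable_const (μ := volume)) ?_).2
  · filter_upwards [hnhds] with s hs
    exact (continuous_invSqrt_integrand hE (hsub s hs)).aestronglyMeasurable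
  · exact hcont.intervalIntegrable _ _
  · exact Continuous.aestronglyMeasurable (by fun_prop)
  · refine Filter.Eventually.of_forall fun θ _ s hs => ?_
    have hb := hC _ (mul_cos_sq_mem_Icc (hsub s hs) θ)
    rw [norm_smul, norm_neg, Real.norm_of_nonneg (sq_nonneg _)]
    calc _ ≤ 1 * (‖Ring.inverse (1 + (s * Real.cos θ ^ 2) • E)‖ * ‖E‖ *
          ‖Ring.inverse (1 + (s * Real.cos θ ^ 2) • E)‖) := by
          gcongr
          · exact Real.cos_sq_le_one θ
          · exact (norm_mul_le _ _).trans (by gcongr; exact norm_mul_le _ _)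
      _ ≤ C * ‖E‖ * C := by rw [one_mul]; gcongr
  · refine Filter.Eventually.of_forall fun θ _ s hs => ?_
    have h1 := hasDerivAt_ringInverse_one_add_smul E
      (hE _ (mul_cos_sq_mem_Icc (hsub s hs) θ))
    have h2 : HasDerivAt (fun s : ℝ => s * Real.cos θ ^ 2) (Real.cos θ ^ 2) s := by
      simpa using (hasDerivAt_id s).mul_const (Real.cos θ ^ 2)
    exact h1.scomp s h2

/-- The boundary terms vanish when the derivative of `sin θ cos θ (1 + s cos²θ E)⁻¹` is integrated
over the quarter circle. -/
theorem integral_deriv_sin_mul_cos_smul (hE : ∀ c ∈ Icc (0 : ℝ) 1, IsUnit (1 + c • E))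
    {s : ℝ} (hs : s ∈ Icc (0 : ℝ) 1) :
    ∫ θ in (0 : ℝ)..Real.pi / 2,
      ((2 * Real.cos θ ^ 2 - 1) • Ring.inverse (1 + (s * Real.cos θ ^ 2) • E) +
      (2 * s * Real.cos θ ^ 2 * (1 - Real.cos θ ^ 2)) •
        (Ring.inverse (1 + (s * Real.cos θ ^ 2) • E) * E *
        Ring.inverse (1 + (s * Real.cos θ ^ 2) • E))) = 0 := by
  have hcont := continuous_invSqrt_integrand hE hs
  rw [intervalIntegral.integral_eq_sub_of_hasDerivAt (f := fun θ =>
    (Real.sin θ * Real.cos θ) • Ring.inverse (1 + (s * Real.cos θ ^ 2) • E))]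
  · simp
  · intro θ _
    have h1 := hasDerivAt_ringInverse_one_add_smul E (hE _ (mul_cos_sq_mem_Icc hs θ))
    have h2 : HasDerivAt (fun θ : ℝ => s * Real.cos θ ^ 2)
        (s * (2 * Real.cos θ * (-Real.sin θ))) θ := by
      simpa using ((Real.hasDerivAt_cos θ).pow 2).const_mul s
    have h3 := ((Real.hasDerivAt_sin θ).mul (Real.hasDerivAt_cos θ)).smul (h1.scomp θ h2)
    refine h3.congr_deriv ?_
    have hsin : Real.sin θ ^ 2 = 1 - Real.cos θ ^ 2 := by
      linear_combination Real.sin_sq_add_cos_sq θ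
    simp only [Function.comp_apply, Pi.mul_apply]
    rw [add_comm, smul_smul, smul_neg, ← neg_smul]
    congr 2
    · linear_combination -hsin
    · linear_combination (2 * s * Real.cos θ ^ 2) * hsin
  · exact Continuous.intervalIntegrable (by fun_prop) _ _

/-- The differential equation `2 (1 + sE) R' = -E R`. -/
theorem invSqrtIntegral_differential_equation
    (hE : ∀ c ∈ Icc (0 : ℝ) 1, IsUnit (1 + c • E)) {s : ℝ} (hs : s ∈ Icc (0 : ℝ) 1) :
    (2 : ℝ) • ((1 + s • E) * ((2 / Real.pi) • ∫ θ in (0 : ℝ)..Real.pi / 2,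
      (Real.cos θ ^ 2) • (-(Ring.inverse (1 + (s * Real.cos θ ^ 2) • E) * E *
        Ring.inverse (1 + (s * Real.cos θ ^ 2) • E))))) = -(E * invSqrtIntegral E s) := by
  have hcont := continuous_invSqrt_integrand hE hs
  have hF : IntervalIntegrable (fun θ => (Real.cos θ ^ 2) •
      (-(Ring.inverse (1 + (s * Real.cos θ ^ 2) • E) * E *
        Ring.inverse (1 + (s * Real.cos θ ^ 2) • E)))) volume 0 (Real.pi / 2) :=
    Continuous.intervalIntegrable (by fun_prop) _ _
  have h0 := congrArg (fun x => -(E * x)) (integral_deriv_sin_mul_cos_smul hE hs)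
  have hG : IntervalIntegrable (fun θ =>
      (2 * Real.cos θ ^ 2 - 1) • Ring.inverse (1 + (s * Real.cos θ ^ 2) • E) +
      (2 * s * Real.cos θ ^ 2 * (1 - Real.cos θ ^ 2)) •
        (Ring.inverse (1 + (s * Real.cos θ ^ 2) • E) * E *
        Ring.inverse (1 + (s * Real.cos θ ^ 2) • E))) volume 0 (Real.pi / 2) :=
    Continuous.intervalIntegrable (by fun_prop) _ _
  have mulL : ∀ (x : 𝔸) (f : ℝ → 𝔸), IntervalIntegrable f volume 0 (Real.pi / 2) →
      x * ∫ θ in (0 : ℝ)..Real.pi / 2, f θ = ∫ θ in (0 : ℝ)..Real.pi / 2, x * f θ :=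
    fun x f hf => ((ContinuousLinearMap.mul ℝ 𝔸 x).intervalIntegral_comp_comm hf).symm
  have hI := hcont.intervalIntegrable (μ := volume) 0 (Real.pi / 2)
  rw [eq_neg_iff_add_eq_zero, invSqrtIntegral, mul_smul_comm, mul_smul_comm, smul_comm, ← smul_add,
    mulL _ _ hF, mulL _ _ hI, ← intervalIntegral.integral_smul, ← intervalIntegral.integral_add]
  · simp only [mul_zero, neg_zero] at h0
    rw [mulL _ _ hG, ← intervalIntegral.integral_neg] at h0
    refine (congrArg ((2 / Real.pi) • ·) (Eq.trans ?_ h0)).trans (smul_zero _)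
    -- the combined integrand is `-E` times the total derivative `d/dθ (sin θ cos θ q)`
    refine intervalIntegral.integral_congr fun θ _ => ?_
    have hu := hE _ (mul_cos_sq_mem_Icc hs θ)
    have hq := Ring.inverse_mul_cancel _ hu
    have hEq := commute_ringInverse_one_add_smul E (s * Real.cos θ ^ 2)
    generalize Ring.inverse (1 + (s * Real.cos θ ^ 2) • E) = q at hq hEq
    have h1 : q * E * q = q * q * E := by rw [mul_assoc, hEq.eq, mul_assoc]
    have h2 : q = q * q + (s * Real.cos θ ^ 2) • (q * q * E) := by
      calc q = q * (q * (1 + (s * Real.cos θ ^ 2) • E)) := by rw [hq, mul_one]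
        _ = _ := by simp only [mul_add, mul_one, mul_smul_comm, mul_assoc]
    have h3 : E * (q * q) = q * q * E := (hEq.mul_right hEq).eq
    have h4 : E * (q * q * E) = q * q * E * E := by rw [← mul_assoc, h3]
    simp only [h1]
    generalize q * q = Q at h2 h3 h4
    rw [h2]
    simp only [mul_add, add_mul, one_mul, smul_mul_assoc, mul_smul_comm, mul_neg, h3, h4]
    module
  · exact Continuous.intervalIntegrable (by fun_prop) _ _
  · exact Continuous.intervalIntegrable (by fun_prop) _ _

/-- `R(s)² (1 + sE) = 1`: the left side has derivative zero and equals `1` at `s = 0`. -/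
theorem invSqrtIntegral_sq (hE : ∀ c ∈ Icc (0 : ℝ) 1, IsUnit (1 + c • E))
    {s : ℝ} (hs : s ∈ Icc (0 : ℝ) 1) :
    invSqrtIntegral E s * invSqrtIntegral E s * (1 + s • E) = 1 := by
  have hcont : ContinuousOn
      (fun s => invSqrtIntegral E s * invSqrtIntegral E s * (1 + s • E)) (Icc 0 1) := by
    have := continuousOn_invSqrtIntegral hE
    fun_prop
  have hderiv : ∀ s ∈ Ioo (0 : ℝ) 1, HasDerivAt
      (fun s => invSqrtIntegral E s * invSqrtIntegral E s * (1 + s • E)) 0 s := by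
    intro s hs
    have hs' := Ioo_subset_Icc_self hs
    have hR := hasDerivAt_invSqrtIntegral hE hs
    have hode := invSqrtIntegral_differential_equation hE hs'
    have hER : Commute E (invSqrtIntegral E s) :=
      commute_invSqrtIntegral hE hs' (commute_ringInverse_one_add_smul E)
    have hRq : ∀ c : ℝ, Commute (invSqrtIntegral E s) (Ring.inverse (1 + c • E)) := fun c =>
      (commute_invSqrtIntegral hE hs' (commute_ringInverse_ringInverse E c)).symm
    have hc := continuous_invSqrt_integrand hE hs'
    have hint : IntervalIntegrable (fun θ => (Real.cos θ ^ 2) •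
      (-(Ring.inverse (1 + (s * Real.cos θ ^ 2) • E) * E *
        Ring.inverse (1 + (s * Real.cos θ ^ 2) • E)))) volume 0 (Real.pi / 2) :=
      Continuous.intervalIntegrable (by fun_prop) _ _
    have hRR' := (commute_intervalIntegral hint (x := invSqrtIntegral E s) fun θ =>
      ((((hRq _).mul_right hER.symm).mul_right (hRq _)).neg_right).smul_right _).smul_right
        (2 / Real.pi)
    have hER' := (commute_intervalIntegral hint (x := E) fun θ =>
      ((((commute_ringInverse_one_add_smul E _).mul_right (Commute.refl E)).mul_right
        (commute_ringInverse_one_add_smul E _)).neg_right).smul_right _).smul_right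
        (2 / Real.pi)
    generalize (2 / Real.pi) • (∫ θ in (0 : ℝ)..Real.pi / 2, (Real.cos θ ^ 2) •
      (-(Ring.inverse (1 + (s * Real.cos θ ^ 2) • E) * E *
        Ring.inverse (1 + (s * Real.cos θ ^ 2) • E)))) = R' at hR hode hRR' hER'
    have h1 : HasDerivAt (fun s : ℝ => 1 + s • E) E s := by
      simpa using ((hasDerivAt_id s).smul_const E).const_add 1
    refine ((hR.mul hR).mul h1).congr_deriv ?_
    simp only [Pi.mul_apply]
    generalize invSqrtIntegral E s = R at *
    have h2 : (1 + s • E) * R' = R' * (1 + s • E) := by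
      simp only [add_mul, mul_add, one_mul, mul_one, smul_mul_assoc, mul_smul_comm, hER'.eq]
    have h3 : R' * R * (1 + s • E) + R * R' * (1 + s • E) = R * -(E * R) := by
      rw [← hode, h2, ← hRR'.eq, ← two_smul ℝ, mul_assoc, mul_smul_comm]
    rw [add_mul, h3, mul_neg, hER.eq, mul_assoc, neg_add_cancel]
  have hconst : ∀ x ∈ Ioo (0 : ℝ) 1, ∀ y ∈ Ioo (0 : ℝ) 1,
      invSqrtIntegral E x * invSqrtIntegral E x * (1 + x • E) =
      invSqrtIntegral E y * invSqrtIntegral E y * (1 + y • E) := by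
    intro x hx y hy
    refine isOpen_Ioo.is_const_of_deriv_eq_zero isPreconnected_Ioo
      (f := fun s => invSqrtIntegral E s * invSqrtIntegral E s * (1 + s • E))
      (fun s hs => (hderiv s hs).differentiableAt.differentiableWithinAt)
      (fun s hs => (hderiv s hs).deriv) hx hy
  have hEq : EqOn (fun s => invSqrtIntegral E s * invSqrtIntegral E s * (1 + s • E))
      (fun _ => invSqrtIntegral E (1 / 2) * invSqrtIntegral E (1 / 2) * (1 + (1 / 2 : ℝ) • E))
      (Icc 0 1) := by
    refine EqOn.of_subset_closure (s := Ioo 0 1) (fun x hx => hconst x hx _ (by norm_num)) hcont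
      continuousOn_const Ioo_subset_Icc_self ?_
    rw [closure_Ioo zero_ne_one]
  have h0 : invSqrtIntegral E 0 = 1 := by
    simp [invSqrtIntegral, smul_smul, Real.pi_ne_zero]
  have h1 := (hEq hs).trans (hEq (by simp : (0 : ℝ) ∈ Icc (0 : ℝ) 1)).symm
  simpa [h0] using h1

end InverseSqrt

end TProduct

/-! ### Strictly accretive matrices -/

namespace TProduct

open Matrix

theorem submatrix_eq_congruence {ι κ : Type*} [Fintype ι] [DecidableEq ι] (M : Matrix ι ι ℂ)
    (e : κ → ι) : M.submatrix e e = ((1 : Matrix ι ι ℂ).submatrix id e)ᴴ * M *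
      (1 : Matrix ι ι ℂ).submatrix id e := by
  ext i j
  simp [Matrix.mul_apply, Matrix.one_apply]

theorem mulVec_one_submatrix_injective {ι κ : Type*} [Fintype κ] [DecidableEq ι] {e : κ → ι}
    (he : Function.Injective e) :
    Function.Injective ((1 : Matrix ι ι ℂ).submatrix id e).mulVec := by
  classical
  refine fun x y hxy => funext fun i => ?_
  have := congrFun hxy (e i)
  simpa [mulVec, dotProduct, Matrix.one_apply, he.eq_iff] using this

section Accretive

variable {ι κ : Type*} [Fintype ι] [Fintype κ]

/-- A complex square matrix is strictly accretive if the real part of its quadratic form is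
positive off zero. -/
def IsAccretive (M : Matrix ι ι ℂ) : Prop :=
  ∀ x : ι → ℂ, x ≠ 0 → 0 < (star x ⬝ᵥ (M *ᵥ x)).re

theorem star_dotProduct_congruence_mulVec (M : Matrix ι ι ℂ) (X : Matrix ι κ ℂ) (x : κ → ℂ) :
    star x ⬝ᵥ ((Xᴴ * M * X) *ᵥ x) = star (X *ᵥ x) ⬝ᵥ (M *ᵥ (X *ᵥ x)) := by
  rw [star_mulVec, ← dotProduct_mulVec, mulVec_mulVec, mulVec_mulVec]

theorem star_dotProduct_conjTranspose_mulVec (M : Matrix ι ι ℂ) (x : ι → ℂ) :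
    star x ⬝ᵥ (Mᴴ *ᵥ x) = star (star x ⬝ᵥ (M *ᵥ x)) := by
  rw [← star_dotProduct_star, star_star, star_mulVec, ← dotProduct_mulVec]

theorem star_dotProduct_diagonal_mulVec [DecidableEq ι] (d : ι → ℂ) (x : ι → ℂ) :
    star x ⬝ᵥ (diagonal d *ᵥ x) = ∑ i, (Complex.normSq (x i) : ℂ) * d i := by
  refine Finset.sum_congr rfl fun i _ => ?_
  rw [mulVec_diagonal, Pi.star_apply, Complex.normSq_eq_conj_mul_self, RCLike.star_def]
  ring

theorem IsAccretive.isUnit [DecidableEq ι] {M : Matrix ι ι ℂ} (hM : IsAccretive M) : IsUnit M := by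
  rw [← mulVec_injective_iff_isUnit]
  intro x y hxy
  by_contra hne
  have := hM (x - y) (sub_ne_zero.2 hne)
  simp [mulVec_sub, show M *ᵥ x = M *ᵥ y from hxy] at this

theorem IsAccretive.congruence {M : Matrix ι ι ℂ} (hM : IsAccretive M) {X : Matrix ι κ ℂ}
    (hX : Function.Injective X.mulVec) : IsAccretive (Xᴴ * M * X) := fun x hx => by
  rw [star_dotProduct_congruence_mulVec]
  exact hM _ fun h => hx (hX (by rw [h, mulVec_zero]))

theorem IsAccretive.conjTranspose {M : Matrix ι ι ℂ} (hM : IsAccretive M) : IsAccretive Mᴴ :=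
  fun x hx => by
    rw [star_dotProduct_conjTranspose_mulVec]
    simpa using hM x hx

theorem IsAccretive.inv [DecidableEq ι] {M : Matrix ι ι ℂ} (hM : IsAccretive M) :
    IsAccretive M⁻¹ := by
  have hdet := (isUnit_iff_isUnit_det M).1 hM.isUnit
  have h := hM.conjTranspose.congruence (X := M⁻¹)
    (mulVec_injective_of_isUnit ((isUnit_nonsing_inv_iff).2 hM.isUnit))
  rwa [← conjTranspose_mul, mul_nonsing_inv _ hdet, conjTranspose_one, one_mul] at h

theorem IsAccretive.add {M N : Matrix ι ι ℂ} (hM : IsAccretive M) (hN : IsAccretive N) :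
    IsAccretive (M + N) := fun x hx => by
  rw [add_mulVec, dotProduct_add, Complex.add_re]
  exact add_pos (hM x hx) (hN x hx)

theorem IsAccretive.smul {M : Matrix ι ι ℂ} (hM : IsAccretive M) {c : ℝ} (hc : 0 < c) :
    IsAccretive (c • M) := fun x hx => by
  rw [smul_mulVec, dotProduct_smul, Complex.smul_re]
  exact mul_pos hc (hM x hx)

theorem convex_isAccretive : Convex ℝ {M : Matrix ι ι ℂ | IsAccretive M} := by
  intro M hM N hN a b ha hb hab
  rcases ha.eq_or_lt with rfl | ha
  · simpa [show b = 1 by linarith] using hN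
  rcases hb.eq_or_lt with rfl | hb
  · simpa [show a = 1 by linarith] using hM
  · exact IsAccretive.add (IsAccretive.smul hM ha) (IsAccretive.smul hN hb)

theorem isAccretive_diagonal [DecidableEq ι] {d : ι → ℂ} (hd : ∀ i, 0 < (d i).re) :
    IsAccretive (diagonal d) := fun x hx => by
  rw [star_dotProduct_diagonal_mulVec, Complex.re_sum]
  obtain ⟨i, hi⟩ := Function.ne_iff.1 hx
  refine Finset.sum_pos' (fun j _ => ?_) ⟨i, Finset.mem_univ i, ?_⟩
  · rw [Complex.re_ofReal_mul]
    exact mul_nonneg (Complex.normSq_nonneg _) (hd j).le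
  · rw [Complex.re_ofReal_mul]
    exact mul_pos (Complex.normSq_pos.2 hi) (hd i)

theorem isAccretive_one [DecidableEq ι] : IsAccretive (1 : Matrix ι ι ℂ) := by
  rw [← diagonal_one]
  exact isAccretive_diagonal fun _ => by simp

theorem IsAccretive.submatrix {M : Matrix ι ι ℂ} (hM : IsAccretive M) {e : κ → ι}
    (he : Function.Injective e) : IsAccretive (M.submatrix e e) := by
  classical
  rw [submatrix_eq_congruence]
  exact hM.congruence (mulVec_one_submatrix_injective he)

end Accretive

end TProduct

/-! ### Phases of a strictly accretive matrix -/

namespace TProduct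

open Matrix

section Phases

variable {ι κ : Type*} [Fintype ι] [Fintype κ] [DecidableEq ι] [DecidableEq κ]

/-- `M = Tᴴ diag(e^{iφ}) T` for some nonsingular `T`. -/
def HasPhases (M : Matrix ι ι ℂ) (φ : ι → ℝ) : Prop :=
  ∃ T : Matrix ι ι ℂ, IsUnit T ∧
    M = Tᴴ * diagonal (fun i => Complex.exp (Complex.I * (φ i : ℂ))) * T

theorem exp_I_mul_re (x : ℝ) : (Complex.exp (Complex.I * (x : ℂ))).re = Real.cos x := by
  rw [mul_comm, Complex.exp_ofReal_mul_I_re]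

theorem HasPhases.isAccretive {M : Matrix ι ι ℂ} {φ : ι → ℝ} (h : HasPhases M φ)
    (hφ : ∀ i, φ i ∈ Set.Ioo (-(Real.pi / 2)) (Real.pi / 2)) : IsAccretive M := by
  obtain ⟨T, hT, rfl⟩ := h
  refine (isAccretive_diagonal fun i => ?_).congruence (mulVec_injective_of_isUnit hT)
  rw [exp_I_mul_re]
  exact Real.cos_pos_of_mem_Ioo (hφ i)

/-- Testing `M` on the columns of `T⁻¹` shows that the phases of an accretive matrix lie in the
open right half plane. -/
theorem HasPhases.mem_Ioo {M : Matrix ι ι ℂ} {φ : ι → ℝ} (h : HasPhases M φ)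
    (hM : IsAccretive M) (hφ : ∀ i, φ i ∈ Set.Ioc (-Real.pi) Real.pi) (i : ι) :
    φ i ∈ Set.Ioo (-(Real.pi / 2)) (Real.pi / 2) := by
  obtain ⟨T, hT, rfl⟩ := h
  have hdet := (isUnit_iff_isUnit_det T).1 hT
  have hx : T⁻¹ *ᵥ Pi.single i (1 : ℂ) ≠ 0 := fun h0 => by
    have := congrArg (T *ᵥ ·) h0
    simp only [mulVec_mulVec, mul_nonsing_inv _ hdet, one_mulVec, mulVec_zero] at this
    simpa using congrFun this i
  have h1 := hM _ hx
  rw [star_dotProduct_congruence_mulVec, mulVec_mulVec, mul_nonsing_inv _ hdet, one_mulVec,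
    star_dotProduct_diagonal_mulVec, Finset.sum_eq_single i] at h1
  · simp only [Pi.single_eq_same, map_one, Complex.ofReal_one, one_mul, exp_I_mul_re] at h1
    have hi := hφ i
    constructor
    · by_contra! hle
      have := Real.cos_nonpos_of_pi_div_two_le_of_le (x := -φ i) (by linarith)
        (by linarith [hi.1, Real.pi_pos])
      rw [Real.cos_neg] at this
      linarith
    · by_contra! hle
      have := Real.cos_nonpos_of_pi_div_two_le_of_le (x := φ i) hle
        (by linarith [hi.2, Real.pi_pos])
      linarith
  · intro j _ hj
    simp [hj]
  · simp

theorem HasPhases.congruence {M : Matrix ι ι ℂ} {φ : ι → ℝ} (h : HasPhases M φ)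
    {X : Matrix ι ι ℂ} (hX : IsUnit X) : HasPhases (Xᴴ * M * X) φ := by
  obtain ⟨T, hT, rfl⟩ := h
  refine ⟨T * X, hT.mul hX, ?_⟩
  simp only [conjTranspose_mul, Matrix.mul_assoc]

/-- `(M⁻¹)ᴴ` is congruent to `M`, so it has the same phases. -/
theorem HasPhases.conjTranspose_inv {M : Matrix ι ι ℂ} {φ : ι → ℝ} (h : HasPhases M φ)
    (hM : IsUnit M) : HasPhases (M⁻¹)ᴴ φ := by
  have h1 := h.congruence ((isUnit_nonsing_inv_iff).2 hM)
  rwa [Matrix.mul_assoc, mul_nonsing_inv _ ((isUnit_iff_isUnit_det M).1 hM), Matrix.mul_one] at h1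

theorem HasPhases.submatrix_equiv {M : Matrix ι ι ℂ} {φ : ι → ℝ} (h : HasPhases M φ)
    (e : κ ≃ ι) : HasPhases (M.submatrix e e) (φ ∘ e) := by
  obtain ⟨T, hT, rfl⟩ := h
  refine ⟨T.submatrix e e, (isUnit_submatrix_equiv e e).2 hT, ?_⟩
  rw [conjTranspose_submatrix, ← submatrix_mul_equiv _ _ e e e, ← submatrix_mul_equiv _ _ e e e,
    submatrix_diagonal_equiv]
  rfl

theorem HasPhases.comp_perm {M : Matrix ι ι ℂ} {φ : ι → ℝ} (h : HasPhases M φ)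
    (σ : Equiv.Perm ι) : HasPhases M (φ ∘ σ) := by
  obtain ⟨T, hT, rfl⟩ := h
  refine ⟨T.submatrix σ (Equiv.refl ι), (isUnit_submatrix_equiv _ _).2 hT, ?_⟩
  have h1 : diagonal (fun i => Complex.exp (Complex.I * ((φ ∘ σ) i : ℂ))) =
      (diagonal fun i => Complex.exp (Complex.I * (φ i : ℂ))).submatrix σ σ := by
    rw [submatrix_diagonal_equiv]
    rfl
  rw [h1, conjTranspose_submatrix, submatrix_mul_equiv, submatrix_mul_equiv]
  rfl

open scoped ComplexOrder in
theorem exists_isUnit_eq_conjTranspose_mul_self {H : Matrix ι ι ℂ} (hH : H.PosDef) :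
    ∃ S : Matrix ι ι ℂ, IsUnit S ∧ H = Sᴴ * S := by
  open scoped MatrixOrder Matrix.Norms.L2Operator in
  exact CStarAlgebra.isStrictlyPositive_iff_eq_star_mul_self.mp hH.isStrictlyPositive

theorem one_add_I_mul_eq (x : ℝ) : (1 + Complex.I * x : ℂ) =
    (Real.sqrt (1 + x ^ 2) : ℂ) * Complex.exp (Complex.I * (Real.arctan x : ℂ)) := by
  have h : (0 : ℝ) < Real.sqrt (1 + x ^ 2) := Real.sqrt_pos.2 (by positivity)
  rw [mul_comm Complex.I (Real.arctan x : ℂ), Complex.exp_mul_I, ← Complex.ofReal_cos,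
    ← Complex.ofReal_sin, Real.cos_arctan, Real.sin_arctan]
  have h' : (Real.sqrt (1 + x ^ 2) : ℂ) ≠ 0 := by exact_mod_cast h.ne'
  push_cast
  field_simp

open scoped ComplexOrder in
/-- The Hermitian and skew-Hermitian parts `H`, `iK` of an accretive matrix are simultaneously
diagonalised by a congruence that turns `H` into the identity and `K` into a real diagonal
matrix; the phases are the arctangents of its entries. -/
theorem IsAccretive.exists_hasPhases {M : Matrix ι ι ℂ} (hM : IsAccretive M) :
    ∃ φ : ι → ℝ, (∀ i, φ i ∈ Set.Ioo (-(Real.pi / 2)) (Real.pi / 2)) ∧ HasPhases M φ := by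
  set H : Matrix ι ι ℂ := (1 / 2 : ℂ) • (M + Mᴴ) with hHdef
  set K : Matrix ι ι ℂ := (-Complex.I / 2) • (M - Mᴴ) with hKdef
  have hMHK : M = H + Complex.I • K := by
    rw [hHdef, hKdef, smul_smul]
    have : Complex.I * (-Complex.I / 2) = 1 / 2 := by
      linear_combination (-1 / 2 : ℂ) * Complex.I_mul_I
    rw [this]
    module
  have hH : H.PosDef := by
    refine PosDef.of_dotProduct_mulVec_pos ?_ fun x hx => ?_
    · simp [IsHermitian, hHdef, conjTranspose_smul, add_comm]
    · have h1 := hM x hx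
      rw [hHdef, smul_mulVec, dotProduct_smul, add_mulVec, dotProduct_add,
        star_dotProduct_conjTranspose_mulVec, RCLike.star_def, Complex.add_conj]
      rw [smul_eq_mul]
      have : (1 / 2 : ℂ) * ((2 * (star x ⬝ᵥ M *ᵥ x).re : ℝ) : ℂ) =
          (((star x ⬝ᵥ M *ᵥ x).re : ℝ) : ℂ) := by push_cast; ring
      rw [this]
      exact_mod_cast h1
  have hK : Kᴴ = K := by
    rw [hKdef, conjTranspose_smul, conjTranspose_sub, conjTranspose_conjTranspose]
    simp only [star_div₀, star_neg, RCLike.star_def, Complex.conj_I, neg_neg, map_ofNat]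
    module
  obtain ⟨S, hS, hHS⟩ := exists_isUnit_eq_conjTranspose_mul_self hH
  have hSdet := (isUnit_iff_isUnit_det S).1 hS
  have hSSi : S⁻¹ * S = 1 := nonsing_inv_mul _ hSdet
  have hL : ((S⁻¹)ᴴ * K * S⁻¹).IsHermitian := by
    rw [IsHermitian, conjTranspose_mul, conjTranspose_mul, hK, conjTranspose_conjTranspose,
      Matrix.mul_assoc]
  have hspec := hL.spectral_theorem
  set U : Matrix ι ι ℂ := (hL.eigenvectorUnitary : Matrix ι ι ℂ) with hU
  set l := hL.eigenvalues with hl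
  have hUU : U * Uᴴ = 1 := Unitary.mul_star_self_of_mem hL.eigenvectorUnitary.2
  have hspec' : (S⁻¹)ᴴ * K * S⁻¹ = U * diagonal (fun i => (l i : ℂ)) * Uᴴ := by
    rw [Unitary.conjStarAlgAut_apply] at hspec
    exact hspec
  have hSH : Sᴴ * (S⁻¹)ᴴ = 1 := by rw [← conjTranspose_mul, hSSi, conjTranspose_one]
  have hKS : K = Sᴴ * (U * diagonal (fun i => (l i : ℂ)) * Uᴴ) * S := by
    rw [← hspec']
    calc K = (Sᴴ * (S⁻¹)ᴴ) * K * (S⁻¹ * S) := by rw [hSH, hSSi, one_mul, mul_one]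
      _ = _ := by simp only [Matrix.mul_assoc]
  -- the moduli of `1 + iΛ` are split evenly between the two factors `T` and `Tᴴ`
  set r : ι → ℝ := fun i => Real.sqrt (Real.sqrt (1 + l i ^ 2)) with hr
  have hr0 : ∀ i, 0 < r i := fun i => Real.sqrt_pos.2 (Real.sqrt_pos.2 (by positivity))
  refine ⟨fun i => Real.arctan (l i), fun i => Real.arctan_mem_Ioo _,
    diagonal (fun i => (r i : ℂ)) * Uᴴ * S, ?_, ?_⟩
  · refine IsUnit.mul (IsUnit.mul ?_ ?_) hS
    · rw [isUnit_diagonal, Pi.isUnit_iff]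
      exact fun i => isUnit_iff_ne_zero.2 (by exact_mod_cast (hr0 i).ne')
    · exact IsUnit.of_mul_eq_one_right U hUU
  · have hd : diagonal (fun i => (1 + Complex.I * l i : ℂ)) =
        diagonal (fun i => (r i : ℂ)) *
          diagonal (fun i => Complex.exp (Complex.I * (Real.arctan (l i) : ℂ))) *
          diagonal (fun i => (r i : ℂ)) := by
      rw [diagonal_mul_diagonal, diagonal_mul_diagonal]
      congr 1
      funext i
      rw [one_add_I_mul_eq, ← Real.mul_self_sqrt (Real.sqrt_nonneg (1 + l i ^ 2))]
      simp only [hr]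
      push_cast
      ring
    have hd' : diagonal (fun i => (1 + Complex.I * l i : ℂ)) =
        1 + Complex.I • diagonal (fun i => (l i : ℂ)) := by
      rw [← diagonal_one, ← diagonal_smul, diagonal_add]
      rfl
    have hrH : (diagonal (fun i => (r i : ℂ)))ᴴ = diagonal (fun i => (r i : ℂ)) := by
      rw [diagonal_conjTranspose]
      congr 1
      funext i
      simp
    have h1 : M = Sᴴ * U * diagonal (fun i => (1 + Complex.I * l i : ℂ)) * Uᴴ * S := by
      rw [hd', hMHK, hKS, hHS]
      simp only [Matrix.mul_add, Matrix.add_mul, Matrix.mul_one, Matrix.mul_smul, Matrix.smul_mul]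
      rw [Matrix.mul_assoc Sᴴ U, hUU, Matrix.mul_one]
      simp only [Matrix.mul_assoc]
    rw [h1, hd]
    simp only [conjTranspose_mul, conjTranspose_conjTranspose, hrH, Matrix.mul_assoc]

/-- `M⁻¹ Mᴴ` is similar to `diag(e^{-2iφ})`. -/
theorem HasPhases.charpoly_inv_mul_conjTranspose {M : Matrix ι ι ℂ} {φ : ι → ℝ}
    (h : HasPhases M φ) : (M⁻¹ * Mᴴ).charpoly =
      ∏ i, (Polynomial.X - Polynomial.C (Complex.exp (Complex.I * ((-2 * φ i : ℝ) : ℂ)))) := by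
  obtain ⟨T, hT, rfl⟩ := h
  have hD : ∀ ψ : ι → ℝ, IsUnit (diagonal (fun i => Complex.exp (Complex.I * (ψ i : ℂ)))) := by
    intro ψ
    rw [isUnit_diagonal, Pi.isUnit_iff]
    exact fun i => isUnit_iff_ne_zero.2 (Complex.exp_ne_zero _)
  obtain ⟨u, rfl⟩ := hT
  have hM : IsUnit ((u : Matrix ι ι ℂ)ᴴ *
      diagonal (fun i => Complex.exp (Complex.I * (φ i : ℂ))) * (u : Matrix ι ι ℂ)) :=
    (((isUnit_conjTranspose _).2 u.isUnit).mul (hD φ)).mul u.isUnit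
  have key : (((u : Matrix ι ι ℂ)ᴴ *
      diagonal (fun i => Complex.exp (Complex.I * (φ i : ℂ))) * (u : Matrix ι ι ℂ)))ᴴ =
      ((u : Matrix ι ι ℂ)ᴴ *
      diagonal (fun i => Complex.exp (Complex.I * (φ i : ℂ))) * (u : Matrix ι ι ℂ)) *
      ((u⁻¹ : (Matrix ι ι ℂ)ˣ).val *
        diagonal (fun i => Complex.exp (Complex.I * ((-2 * φ i : ℝ) : ℂ))) * u.val) := by
    have h1 : (diagonal (fun i => Complex.exp (Complex.I * (φ i : ℂ))))ᴴ =
        diagonal (fun i => Complex.exp (Complex.I * (φ i : ℂ))) *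
        diagonal (fun i => Complex.exp (Complex.I * ((-2 * φ i : ℝ) : ℂ))) := by
      rw [diagonal_conjTranspose, diagonal_mul_diagonal]
      congr 1
      funext i
      rw [← Complex.exp_add, Pi.star_apply, RCLike.star_def, ← Complex.exp_conj]
      congr 1
      simp only [map_mul, Complex.conj_I, Complex.conj_ofReal]
      push_cast
      ring
    simp only [conjTranspose_mul, conjTranspose_conjTranspose, h1, Matrix.mul_assoc,
      Units.mul_inv_cancel_left]
  rw [key, nonsing_inv_mul_cancel_left _ _ ((isUnit_iff_isUnit_det _).1 hM),
    coe_units_inv, charpoly_units_conj', charpoly_diagonal]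

theorem eq_of_antitone_of_map_univ_eq {N : ℕ} {f g : Fin N → ℝ} (hf : Antitone f)
    (hg : Antitone g)
    (h : Multiset.map f Finset.univ.val = Multiset.map g Finset.univ.val) : f = g := by
  rw [Fin.univ_val_map, Fin.univ_val_map, Multiset.coe_eq_coe] at h
  refine List.ofFn_injective (h.eq_of_pairwise (le := (· ≥ ·)) ?_ ?_ ?_)
  · intro a b _ _ h1 h2
    exact le_antisymm h2 h1
  · exact List.pairwise_ofFn.2 fun i j hij => hf hij.le
  · exact List.pairwise_ofFn.2 fun i j hij => hg hij.le

theorem HasPhases.eq_of_antitone {N : ℕ} {M : Matrix (Fin N) (Fin N) ℂ} {φ ψ : Fin N → ℝ}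
    (hφ : HasPhases M φ) (hψ : HasPhases M ψ) (hφ' : Antitone φ) (hψ' : Antitone ψ)
    (hφI : ∀ i, φ i ∈ Set.Ioo (-(Real.pi / 2)) (Real.pi / 2))
    (hψI : ∀ i, ψ i ∈ Set.Ioo (-(Real.pi / 2)) (Real.pi / 2)) : φ = ψ := by
  have h := congrArg Polynomial.roots (hφ.charpoly_inv_mul_conjTranspose.symm.trans
    hψ.charpoly_inv_mul_conjTranspose)
  have hroots : ∀ f : Fin N → ℂ,
      (∏ i, (Polynomial.X - Polynomial.C (f i))).roots = Multiset.map f Finset.univ.val := by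
    intro f
    rw [← Polynomial.roots_multiset_prod_X_sub_C (Multiset.map f _), Multiset.map_map]
    rfl
  rw [hroots, hroots] at h
  -- `-2φ` lies in `(-π, π)`, so the principal argument recovers `φ` from the eigenvalue
  have harg : ∀ x ∈ Set.Ioo (-(Real.pi / 2)) (Real.pi / 2),
      -(Complex.exp (Complex.I * ((-2 * x : ℝ) : ℂ))).arg / 2 = x := by
    intro x hx
    rw [mul_comm, Complex.arg_exp_mul_I, (toIocMod_eq_self Real.two_pi_pos).2]
    · ring
    · constructor <;> linarith [hx.1, hx.2]
  have h2 := congrArg (Multiset.map fun z : ℂ => -z.arg / 2) h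
  rw [Multiset.map_map, Multiset.map_map] at h2
  refine eq_of_antitone_of_map_univ_eq hφ' hψ' ?_
  convert! h2 using 2
  · exact (harg _ (hφI _)).symm
  · exact (harg _ (hψI _)).symm

/-- An accretive matrix of size `N` has phases that decrease along `Fin N`. -/
theorem IsAccretive.exists_antitone_hasPhases {N : ℕ} {M : Matrix (Fin N) (Fin N) ℂ}
    (hM : IsAccretive M) : ∃ φ : Fin N → ℝ, Antitone φ ∧
      (∀ i, φ i ∈ Set.Ioo (-(Real.pi / 2)) (Real.pi / 2)) ∧ HasPhases M φ := by
  obtain ⟨φ, hφ, h⟩ := hM.exists_hasPhases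
  refine ⟨φ ∘ Tuple.sort (-φ), fun i j hij => ?_, fun i => hφ _, h.comp_perm _⟩
  exact neg_le_neg_iff.1 (Tuple.monotone_sort (-φ) hij)

end Phases

end TProduct

/-! ### The continuous argument of the determinant -/

namespace TProduct

open Matrix

section ArgDet

variable {ι : Type*} [Fintype ι] [DecidableEq ι]

theorem eq_norm_mul_exp_of_eq {z : ℂ} {r θ : ℝ} (hr : 0 ≤ r)
    (h : z = r * Complex.exp (Complex.I * θ)) : z = ‖z‖ * Complex.exp (Complex.I * θ) := by
  have : ‖z‖ = r := by
    rw [h, mul_comm Complex.I, norm_mul, Complex.norm_exp_ofReal_mul_I, mul_one, Complex.norm_real,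
      Real.norm_of_nonneg hr]
  rw [this, ← h]

variable (ι) in
/-- The accretive matrices form a convex set, so the map `M ↦ det M / |det M|` to the circle lifts
through the covering `ℝ → S¹`. -/
theorem exists_argDet : ∃ Φ : Matrix ι ι ℂ → ℝ, ContinuousOn Φ {M | IsAccretive M} ∧ Φ 1 = 0 ∧
    ∀ M, IsAccretive M → M.det = ‖M.det‖ * Complex.exp (Complex.I * Φ M) := by
  have hconv := convex_isAccretive (ι := ι)
  have : ContractibleSpace {M : Matrix ι ι ℂ | IsAccretive M} :=
    hconv.contractibleSpace ⟨1, isAccretive_one⟩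
  have : LocallyConvexSpace ℝ (Matrix ι ι ℂ) :=
    inferInstanceAs (LocallyConvexSpace ℝ (ι → ι → ℂ))
  have : LocallyPathConnectedSpace {M : Matrix ι ι ℂ | IsAccretive M} :=
    hconv.locallyPathConnectedSpace
  have hdet : ∀ M : {M : Matrix ι ι ℂ | IsAccretive M}, M.1.det ≠ 0 := fun M =>
    ((isUnit_iff_isUnit_det _).1 M.2.isUnit).ne_zero
  let f : C({M : Matrix ι ι ℂ | IsAccretive M}, Circle) :=
    ⟨fun M => ⟨M.1.det / ‖M.1.det‖, by simp [Submonoid.unitSphere, hdet M]⟩, by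
      refine Continuous.subtype_mk ?_ _
      have h : Continuous fun M : {M : Matrix ι ι ℂ | IsAccretive M} => M.1.det :=
        continuous_subtype_val.matrix_det
      refine h.div (Complex.continuous_ofReal.comp h.norm) fun M => ?_
      simpa using hdet M⟩
  obtain ⟨F, ⟨hF1, hF⟩, -⟩ := Circle.isCoveringMap_exp.existsUnique_continuousMap_lifts f
    ⟨1, isAccretive_one⟩ 0 (Circle.ext (by
      change Circle.exp 0 = (1 : Matrix ι ι ℂ).det / (‖(1 : Matrix ι ι ℂ).det‖ : ℂ)
      simp))
  classical
  refine ⟨fun M => if h : IsAccretive M then F ⟨M, h⟩ else 0, ?_, ?_, fun M hM => ?_⟩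
  · rw [continuousOn_iff_continuous_domRestrict]
    convert! F.continuous using 1
    funext M
    exact dif_pos M.2
  · simp only [dif_pos isAccretive_one, hF1]
  · simp only [dif_pos hM]
    have h1 := congrArg (fun z : Circle => (z : ℂ)) (congrFun hF ⟨M, hM⟩)
    simp only [Function.comp_apply, Circle.coe_exp] at h1
    rw [mul_comm Complex.I, h1]
    have h2 : (‖M.det‖ : ℂ) ≠ 0 := by simpa using hdet ⟨M, hM⟩
    change M.det = ‖M.det‖ * (M.det / ‖M.det‖)
    field_simp

/-- The continuous argument of the determinant on accretive matrices that vanishes at `1`. -/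
noncomputable def argDet (M : Matrix ι ι ℂ) : ℝ := (exists_argDet ι).choose M

theorem continuousOn_argDet : ContinuousOn argDet {M : Matrix ι ι ℂ | IsAccretive M} :=
  (exists_argDet ι).choose_spec.1

theorem argDet_one : argDet (1 : Matrix ι ι ℂ) = 0 := (exists_argDet ι).choose_spec.2.1

theorem IsAccretive.det_eq {M : Matrix ι ι ℂ} (hM : IsAccretive M) :
    M.det = ‖M.det‖ * Complex.exp (Complex.I * argDet M) :=
  (exists_argDet ι).choose_spec.2.2 M hM

/-- Uniqueness of lifts of a path through the covering of the circle by the line. -/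
theorem eq_of_exp_eq_of_continuousOn {f g : ℝ → ℝ} (hf : ContinuousOn f (Set.Icc 0 1))
    (hg : ContinuousOn g (Set.Icc 0 1))
    (h : ∀ s ∈ Set.Icc (0 : ℝ) 1, Complex.exp (Complex.I * f s) = Complex.exp (Complex.I * g s))
    (h0 : f 0 = g 0) : f 1 = g 1 := by
  refine Circle.isCoveringMap_exp.eqOn_of_comp_eqOn isPreconnected_Icc hf hg (fun s hs => ?_)
    (Set.left_mem_Icc.2 zero_le_one) h0 (Set.right_mem_Icc.2 zero_le_one)
  ext
  simp only [Function.comp_apply, Circle.coe_exp]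
  rw [mul_comm, h s hs, mul_comm]

theorem IsAccretive.exp_argDet_eq {M : Matrix ι ι ℂ} (hM : IsAccretive M) {r θ : ℝ} (hr : 0 ≤ r)
    (h : M.det = r * Complex.exp (Complex.I * θ)) :
    Complex.exp (Complex.I * argDet M) = Complex.exp (Complex.I * θ) := by
  have h1 := (hM.det_eq).symm.trans (eq_norm_mul_exp_of_eq hr h)
  refine mul_left_cancel₀ ?_ h1
  have := ((isUnit_iff_isUnit_det _).1 hM.isUnit).ne_zero
  simpa using this

/-- Along a path of accretive matrices, a continuous choice of the argument of the determinant
which starts as `argDet` stays equal to it. -/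
theorem argDet_eq_of_path {M : ℝ → Matrix ι ι ℂ} {r θ : ℝ → ℝ} (hM : ContinuousOn M (Set.Icc 0 1))
    (hacc : ∀ s ∈ Set.Icc (0 : ℝ) 1, IsAccretive (M s)) (hθ : ContinuousOn θ (Set.Icc 0 1))
    (hr : ∀ s ∈ Set.Icc (0 : ℝ) 1, 0 ≤ r s)
    (hdet : ∀ s ∈ Set.Icc (0 : ℝ) 1, (M s).det = r s * Complex.exp (Complex.I * θ s))
    (h0 : argDet (M 0) = θ 0) : argDet (M 1) = θ 1 :=
  eq_of_exp_eq_of_continuousOn (f := fun s => argDet (M s))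
    (continuousOn_argDet.comp hM hacc) hθ
    (fun s hs => (hacc s hs).exp_argDet_eq (hr s hs) (hdet s hs)) h0

open scoped ComplexOrder in
/-- The determinant stays positive along the segment from `1` to the positive definite `Tᴴ T`. -/
theorem argDet_conjTranspose_mul_self {T : Matrix ι ι ℂ} (hT : IsUnit T) :
    argDet (Tᴴ * T) = 0 := by
  have hacc : IsAccretive (Tᴴ * T) := by
    have := isAccretive_one.congruence (mulVec_injective_of_isUnit hT)
    rwa [Matrix.mul_one] at this
  have hpath : ∀ s ∈ Set.Icc (0 : ℝ) 1, IsAccretive ((1 - s) • (1 : Matrix ι ι ℂ) + s • (Tᴴ * T)) :=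
    fun s hs => convex_isAccretive isAccretive_one hacc (sub_nonneg.2 hs.2) hs.1 (by ring)
  have h := argDet_eq_of_path (M := fun s : ℝ => (1 - s) • (1 : Matrix ι ι ℂ) + s • (Tᴴ * T))
    (r := fun s => ((1 - s) • (1 : Matrix ι ι ℂ) + s • (Tᴴ * T)).det.re) (θ := fun _ => 0)
    (by fun_prop) hpath continuousOn_const ?_ ?_ (by simp [argDet_one])
  · simpa using h
  all_goals
    intro s hs
    have hpos : ((1 - s) • (1 : Matrix ι ι ℂ) + s • (Tᴴ * T)).PosDef := by
      have hherm : ((1 - s) • (1 : Matrix ι ι ℂ) + s • (Tᴴ * T)).IsHermitian := by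
        simp [IsHermitian, conjTranspose_add, conjTranspose_smul]
      refine PosDef.of_dotProduct_mulVec_pos hherm fun x hx => ?_
      rw [Complex.pos_iff]
      refine ⟨hpath s hs x hx, ?_⟩
      have := star_dotProduct_conjTranspose_mulVec
        ((1 - s) • (1 : Matrix ι ι ℂ) + s • (Tᴴ * T)) x
      rw [hherm.eq] at this
      exact (Complex.conj_eq_iff_im.1 this.symm).symm
    have hdet := Complex.pos_iff.1 hpos.det_pos
  · exact hdet.1.le
  · simp only [Complex.ofReal_zero, mul_zero, Complex.exp_zero, mul_one]
    exact Complex.ext rfl (by simpa using hdet.2.symm)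

/-- `argDet` is the sum of the phases, as seen along the path `s ↦ Tᴴ diag(e^{isφ}) T`. -/
theorem HasPhases.argDet_eq {M : Matrix ι ι ℂ} {φ : ι → ℝ} (h : HasPhases M φ)
    (hφ : ∀ i, φ i ∈ Set.Ioo (-(Real.pi / 2)) (Real.pi / 2)) : argDet M = ∑ i, φ i := by
  obtain ⟨T, hT, rfl⟩ := h
  have hpath : ∀ s ∈ Set.Icc (0 : ℝ) 1, IsAccretive
      (Tᴴ * diagonal (fun i => Complex.exp (Complex.I * ((s * φ i : ℝ) : ℂ))) * T) := by
    intro s hs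
    refine HasPhases.isAccretive (φ := fun i => s * φ i) ⟨T, hT, rfl⟩ fun i => ?_
    have hi := hφ i
    constructor <;> nlinarith [hi.1, hi.2, hs.1, hs.2, Real.pi_pos]
  have h := argDet_eq_of_path (M := fun s : ℝ =>
      Tᴴ * diagonal (fun i => Complex.exp (Complex.I * ((s * φ i : ℝ) : ℂ))) * T)
    (r := fun s => Complex.normSq T.det) (θ := fun s => s * ∑ i, φ i)
    (by fun_prop) hpath (by fun_prop) (fun _ _ => Complex.normSq_nonneg _) ?_ ?_
  · simpa using h
  · intro s hs
    rw [det_mul, det_mul, det_conjTranspose, det_diagonal, ← Complex.exp_sum,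
      Complex.normSq_eq_conj_mul_self, RCLike.star_def]
    push_cast
    rw [Finset.mul_sum, Finset.mul_sum]
    ring
  · simp [argDet_conjTranspose_mul_self hT]

end ArgDet

/-! ### Interlacing of phases -/

section Interlacing

theorem im_exp_mul_sum {ι : Type*} [Fintype ι] (θ : ℝ) (x : ι → ℂ) (φ : ι → ℝ) :
    (Complex.exp (Complex.I * ((-θ : ℝ) : ℂ)) *
      ∑ i, (Complex.normSq (x i) : ℂ) * Complex.exp (Complex.I * (φ i : ℂ))).im =
      ∑ i, Complex.normSq (x i) * Real.sin (φ i - θ) := by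
  rw [Finset.mul_sum, Complex.im_sum]
  refine Finset.sum_congr rfl fun i _ => ?_
  have : Complex.exp (Complex.I * ((-θ : ℝ) : ℂ)) *
      ((Complex.normSq (x i) : ℂ) * Complex.exp (Complex.I * (φ i : ℂ))) =
      (Complex.normSq (x i) : ℂ) * Complex.exp (((φ i - θ : ℝ) : ℂ) * Complex.I) := by
    rw [mul_left_comm, ← Complex.exp_add]
    congr 2
    push_cast
    ring
  rw [this, Complex.im_ofReal_mul, Complex.exp_ofReal_mul_I_im]

/-- The phases of a compression `Xᴴ M X` to a space of dimension `k` are bounded by the `k` largest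
phases of `M`. For each `j` some nonzero vector is in the span of the first `j + 1` phase vectors
of the compression and is mapped by `X` to the span of the phase vectors of `M` from the `j`-th on;
the value of the quadratic form there has argument at least `ψ j` and at most `φ j`. -/
theorem HasPhases.compression_le {N k : ℕ} (hk : k ≤ N) {M : Matrix (Fin N) (Fin N) ℂ}
    {φ : Fin N → ℝ} (hM : HasPhases M φ) (hφ : Antitone φ)
    (hφI : ∀ i, φ i ∈ Set.Ioo (-(Real.pi / 2)) (Real.pi / 2))
    {X : Matrix (Fin N) (Fin k) ℂ} (hX : Function.Injective X.mulVec) {ψ : Fin k → ℝ}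
    (hC : HasPhases (Xᴴ * M * X) ψ) (hψ : Antitone ψ)
    (hψI : ∀ i, ψ i ∈ Set.Ioo (-(Real.pi / 2)) (Real.pi / 2)) (j : Fin k) :
    ψ j ≤ φ (Fin.castLE hk j) := by
  obtain ⟨T, hT, rfl⟩ := hM
  obtain ⟨S, hS, hCS⟩ := hC
  have hSdet := (isUnit_iff_isUnit_det S).1 hS
  set Y : Matrix (Fin N) (Fin k) ℂ := T * X * S⁻¹ with hY
  have hYinj : Function.Injective Y.mulVec := by
    have h1 := mulVec_injective_of_isUnit hT
    have h2 := mulVec_injective_of_isUnit ((isUnit_nonsing_inv_iff).2 hS)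
    have : Y.mulVec = T.mulVec ∘ X.mulVec ∘ S⁻¹.mulVec := by
      funext x
      simp [hY, mulVec_mulVec, Matrix.mul_assoc]
    rw [this]
    exact h1.comp (hX.comp h2)
  have hD : diagonal (fun i => Complex.exp (Complex.I * (ψ i : ℂ))) =
      Yᴴ * diagonal (fun i => Complex.exp (Complex.I * (φ i : ℂ))) * Y := by
    have h1 : S * S⁻¹ = 1 := mul_nonsing_inv _ hSdet
    have h2 : (S⁻¹)ᴴ * Sᴴ = 1 := by rw [← conjTranspose_mul, h1, conjTranspose_one]
    calc _ = ((S⁻¹)ᴴ * Sᴴ) * diagonal (fun i => Complex.exp (Complex.I * (ψ i : ℂ))) *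
          (S * S⁻¹) := by rw [h1, h2, Matrix.one_mul, Matrix.mul_one]
      _ = (S⁻¹)ᴴ * (Sᴴ * diagonal (fun i => Complex.exp (Complex.I * (ψ i : ℂ))) * S) * S⁻¹ := by
          simp only [Matrix.mul_assoc]
      _ = _ := by
          rw [← hCS, hY]
          simp only [conjTranspose_mul, Matrix.mul_assoc]
  -- one row of the system is zero, so that it has a nontrivial solution
  obtain ⟨w, hw0, hw⟩ := (exists_mulVec_eq_zero_iff (M := Matrix.of fun i l : Fin k =>
      if i < j then Y (Fin.castLE hk i) l else if i = j then 0 else (1 : Matrix _ _ ℂ) i l)).2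
    (det_eq_zero_of_row_eq_zero j (by simp))
  have hw1 : ∀ i, j < i → w i = 0 := by
    intro i hi
    have := congrFun hw i
    simpa [mulVec, dotProduct, hi.not_gt, hi.ne', Matrix.one_apply] using this
  have hw2 : ∀ i : Fin N, i < Fin.castLE hk j → (Y *ᵥ w) i = 0 := by
    intro i hi
    have hlt : (i : ℕ) < j := hi
    have := congrFun hw ⟨i, hlt.trans j.2⟩
    have h2 : (⟨i, hlt.trans j.2⟩ : Fin k) < j := hlt
    simpa [mulVec, dotProduct, h2] using this
  have hYw : Y *ᵥ w ≠ 0 := fun h => hw0 (hYinj (by rw [h, mulVec_zero]))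
  by_contra! hlt
  have hz := congrArg (fun D => star w ⬝ᵥ (D *ᵥ w)) hD
  simp only [star_dotProduct_congruence_mulVec] at hz
  rw [star_dotProduct_diagonal_mulVec, star_dotProduct_diagonal_mulVec] at hz
  have him := congrArg (fun z => (Complex.exp (Complex.I * ((-ψ j : ℝ) : ℂ)) * z).im) hz
  rw [im_exp_mul_sum, im_exp_mul_sum] at him
  have hpos : 0 ≤ ∑ i, Complex.normSq (w i) * Real.sin (ψ i - ψ j) := by
    refine Finset.sum_nonneg fun i _ => ?_
    rcases le_or_gt i j with hij | hij
    · refine mul_nonneg (Complex.normSq_nonneg _) (Real.sin_nonneg_of_nonneg_of_le_pi ?_ ?_)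
      · linarith [hψ hij]
      · linarith [(hψI i).2, (hψI j).1]
    · simp [hw1 i hij]
  have hneg : ∀ i, Fin.castLE hk j ≤ i → Real.sin (φ i - ψ j) < 0 := by
    intro i hi
    refine Real.sin_neg_of_neg_of_neg_pi_lt ?_ ?_
    · linarith [hφ hi]
    · linarith [(hφI i).1, (hψI j).2]
  have hsum : ∑ i, Complex.normSq ((Y *ᵥ w) i) * Real.sin (φ i - ψ j) < 0 := by
    obtain ⟨i, hi⟩ := Function.ne_iff.1 hYw
    refine Finset.sum_neg' (fun l _ => ?_) ⟨i, Finset.mem_univ i, ?_⟩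
    · rcases lt_or_ge l (Fin.castLE hk j) with h | h
      · simp [hw2 l h]
      · exact mul_nonpos_of_nonneg_of_nonpos (Complex.normSq_nonneg _) (hneg l h).le
    · have h : Fin.castLE hk j ≤ i := by
        by_contra! h
        exact hi (hw2 i h)
      exact mul_neg_of_pos_of_neg (Complex.normSq_pos.2 hi) (hneg i h)
  linarith

end Interlacing

end TProduct

/-! ### Majorization of the phases of a solution of `G M⁻¹ G = N` -/

namespace TProduct

open Matrix

section Majorization

theorem HasPhases.argDet_submatrix_le {N k : ℕ} (hk : k ≤ N) {A : Matrix (Fin N) (Fin N) ℂ}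
    {φ : Fin N → ℝ} (hA : HasPhases A φ) (hφ : Antitone φ)
    (hφI : ∀ i, φ i ∈ Set.Ioo (-(Real.pi / 2)) (Real.pi / 2)) :
    argDet (A.submatrix (Fin.castLE hk) (Fin.castLE hk)) ≤ ∑ j, φ (Fin.castLE hk j) := by
  have he : Function.Injective (Fin.castLE hk) := Fin.castLE_injective hk
  obtain ⟨ψ, hψ, hψI, h⟩ := ((hA.isAccretive hφI).submatrix he).exists_antitone_hasPhases
  rw [h.argDet_eq hψI]
  rw [submatrix_eq_congruence] at h
  exact Finset.sum_le_sum fun j _ =>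
    hA.compression_le hk hφ hφI (mulVec_one_submatrix_injective he) h hψ hψI j

/-- If `N = D P D` with `D = diag(e^{iγ})` and `N`, `P` accretive, then corresponding diagonal
blocks satisfy `arg det N + arg det Pᴴ = 2 ∑ γ` exactly, not only modulo `2π`: the segment from
`(D, D⁻¹)` to `(N, P)` consists of such pairs. -/
theorem argDet_submatrix_diagonal_congruence {ι κ : Type*} [Fintype ι] [DecidableEq ι] [Fintype κ]
    [DecidableEq κ] {e : κ → ι} (he : Function.Injective e) {γ : ι → ℝ}
    (hγ : ∀ i, γ i ∈ Set.Ioo (-(Real.pi / 2)) (Real.pi / 2)) {P : Matrix ι ι ℂ}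
    (hP : IsAccretive P)
    (hN : IsAccretive (diagonal (fun i => Complex.exp (Complex.I * (γ i : ℂ))) * P *
      diagonal (fun i => Complex.exp (Complex.I * (γ i : ℂ))))) :
    argDet ((diagonal (fun i => Complex.exp (Complex.I * (γ i : ℂ))) * P *
      diagonal (fun i => Complex.exp (Complex.I * (γ i : ℂ)))).submatrix e e) =
      2 * ∑ j, γ (e j) - argDet (Pᴴ.submatrix e e) := by
  set D := diagonal (fun i => Complex.exp (Complex.I * (γ i : ℂ))) with hD
  have hDphases : HasPhases D γ := ⟨1, isUnit_one, by simp [hD]⟩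
  have hDacc : IsAccretive D := hDphases.isAccretive hγ
  have hDD : D * Dᴴ = 1 := by
    rw [hD, diagonal_conjTranspose, diagonal_mul_diagonal, ← diagonal_one]
    congr 1
    funext i
    rw [Pi.star_apply, RCLike.star_def, ← Complex.exp_conj, ← Complex.exp_add]
    simp
  have hDe : argDet (D.submatrix e e) = ∑ j, γ (e j) := by
    refine HasPhases.argDet_eq (φ := γ ∘ e) ⟨1, isUnit_one, ?_⟩ fun j => hγ _
    rw [hD, submatrix_diagonal _ _ he]
    simp [Function.comp_def]
  -- `Dᴴ` is the inverse of `D`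
  set Q : ℝ → Matrix ι ι ℂ := fun s => (1 - s) • Dᴴ + s • P with hQ
  have hQacc : ∀ s ∈ Set.Icc (0 : ℝ) 1, IsAccretive (Q s) := fun s hs =>
    convex_isAccretive hDacc.conjTranspose hP (sub_nonneg.2 hs.2) hs.1 (by ring)
  have hDQ : ∀ s, D * Q s * D = (1 - s) • D + s • (D * P * D) := by
    intro s
    simp only [hQ, Matrix.mul_add, Matrix.add_mul, Matrix.mul_smul, Matrix.smul_mul]
    rw [hDD, Matrix.one_mul]
  have hDQacc : ∀ s ∈ Set.Icc (0 : ℝ) 1, IsAccretive (D * Q s * D) := fun s hs => by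
    rw [hDQ]
    exact convex_isAccretive hDacc hN (sub_nonneg.2 hs.2) hs.1 (by ring)
  have hQcont : Continuous Q := by fun_prop
  have hQHcont : ContinuousOn (fun s => argDet ((Q s)ᴴ.submatrix e e)) (Set.Icc 0 1) :=
    continuousOn_argDet.comp (by fun_prop) fun s hs => (hQacc s hs).conjTranspose.submatrix he
  have key := argDet_eq_of_path (M := fun s => (D * Q s * D).submatrix e e)
    (r := fun s => ‖((Q s)ᴴ.submatrix e e).det‖)
    (θ := fun s => 2 * ∑ j, γ (e j) - argDet ((Q s)ᴴ.submatrix e e))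
    (by fun_prop) (fun s hs => (hDQacc s hs).submatrix he) (by fun_prop)
    (fun _ _ => norm_nonneg _) ?_ ?_
  · simpa [hQ] using key
  · intro s hs
    have h1 := ((hQacc s hs).conjTranspose.submatrix he).det_eq
    have h2 : ((Q s).submatrix e e).det = star ((Q s)ᴴ.submatrix e e).det := by
      rw [← det_conjTranspose, conjTranspose_submatrix, conjTranspose_conjTranspose]
    have h3 : (D * Q s * D).submatrix e e =
        D.submatrix e e * (Q s).submatrix e e * D.submatrix e e := by
      rw [hD, submatrix_diagonal _ _ he]
      ext i j
      simp
    have h4 : (D.submatrix e e).det = Complex.exp (Complex.I * ((∑ j, γ (e j) : ℝ) : ℂ)) := by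
      rw [hD, submatrix_diagonal _ _ he, det_diagonal, Complex.ofReal_sum, Finset.mul_sum,
        Complex.exp_sum]
      rfl
    generalize ((Q s)ᴴ.submatrix e e).det = z at h1 h2 ⊢
    generalize argDet ((Q s)ᴴ.submatrix e e) = b at h1 ⊢
    rw [h3, det_mul, det_mul, h2, h4, h1, star_mul', RCLike.star_def, Complex.conj_ofReal,
      ← Complex.exp_conj, map_mul, Complex.conj_I, Complex.conj_ofReal]
    generalize (∑ j, γ (e j)) = σ
    have : Complex.exp (Complex.I * ((2 * σ - b : ℝ) : ℂ)) =
        Complex.exp (Complex.I * (σ : ℂ)) * Complex.exp (-Complex.I * b) *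
        Complex.exp (Complex.I * (σ : ℂ)) := by
      rw [← Complex.exp_add, ← Complex.exp_add]
      congr 1
      push_cast
      ring
    rw [this, norm_mul, mul_comm Complex.I (b : ℂ), Complex.norm_exp_ofReal_mul_I, mul_one,
      Complex.norm_real, norm_norm]
    ring
  · simp only [hDQ]
    simp only [hQ, sub_zero, one_smul, zero_smul, add_zero, conjTranspose_conjTranspose, hDe]
    ring

/-- If `G M⁻¹ G = N`, then a congruence which diagonalises `G` turns `N` into `D P D`, where `P` is
congruent to `M⁻¹` and hence `Pᴴ` to `M`; the diagonal blocks of `N` and `Pᴴ` are compressions, so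
their phases are controlled by interlacing. -/
theorem two_mul_sum_phases_le {n : ℕ} {M N G : Matrix (Fin n) (Fin n) ℂ} {μ ν γ : Fin n → ℝ}
    (hM : HasPhases M μ) (hN : HasPhases N ν) (hG : HasPhases G γ)
    (hμ : Antitone μ) (hν : Antitone ν)
    (hμI : ∀ i, μ i ∈ Set.Ioo (-(Real.pi / 2)) (Real.pi / 2))
    (hνI : ∀ i, ν i ∈ Set.Ioo (-(Real.pi / 2)) (Real.pi / 2))
    (hγI : ∀ i, γ i ∈ Set.Ioo (-(Real.pi / 2)) (Real.pi / 2))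
    (hGMG : G * M⁻¹ * G = N) :
    (∀ k, ∀ hk : k ≤ n, 2 * ∑ j, γ (Fin.castLE hk j) ≤
      ∑ j, μ (Fin.castLE hk j) + ∑ j, ν (Fin.castLE hk j)) ∧
    2 * ∑ j, γ j = ∑ j, μ j + ∑ j, ν j := by
  obtain ⟨T, hT, hGT⟩ := hG
  have hTdet := (isUnit_iff_isUnit_det T).1 hT
  have hTi : IsUnit T⁻¹ := (isUnit_nonsing_inv_iff).2 hT
  have hTH : IsUnit Tᴴ := (isUnit_conjTranspose _).2 hT
  set D := diagonal (fun i => Complex.exp (Complex.I * (γ i : ℂ))) with hD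
  set P := T * M⁻¹ * Tᴴ with hP
  have hMacc := hM.isAccretive hμI
  have hPacc : IsAccretive P := by
    have := hMacc.inv.congruence (mulVec_injective_of_isUnit hTH)
    rwa [conjTranspose_conjTranspose] at this
  have hPphases : HasPhases Pᴴ μ := by
    have := (hM.conjTranspose_inv hMacc.isUnit).congruence hTH
    rwa [conjTranspose_conjTranspose, show T * (M⁻¹)ᴴ * Tᴴ = Pᴴ by
      simp only [hP, conjTranspose_mul, conjTranspose_conjTranspose, Matrix.mul_assoc]] at this
  have hTT : T * T⁻¹ = 1 := mul_nonsing_inv _ hTdet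
  have hTTH : (T⁻¹)ᴴ * Tᴴ = 1 := by rw [← conjTranspose_mul, hTT, conjTranspose_one]
  have hN' : HasPhases (D * P * D) ν := by
    have h := hN.congruence hTi
    have : (T⁻¹)ᴴ * N * T⁻¹ = D * P * D := by
      rw [← hGMG, hGT, hP]
      calc _ = ((T⁻¹)ᴴ * Tᴴ) * D * T * M⁻¹ * Tᴴ * D * (T * T⁻¹) := by
            simp only [Matrix.mul_assoc]
        _ = _ := by
            rw [hTT, hTTH]
            simp only [Matrix.mul_assoc, Matrix.mul_one, Matrix.one_mul]
    rwa [this] at h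
  have key : ∀ {k : ℕ} (e : Fin k → Fin n), Function.Injective e →
      argDet ((D * P * D).submatrix e e) = 2 * ∑ j, γ (e j) - argDet (Pᴴ.submatrix e e) :=
    fun e he => argDet_submatrix_diagonal_congruence he hγI hPacc (hN'.isAccretive hνI)
  constructor
  · intro k hk
    have h := key _ (Fin.castLE_injective hk)
    have h1 := hN'.argDet_submatrix_le hk hν hνI
    have h2 := hPphases.argDet_submatrix_le hk hμ hμI
    linarith
  · have h := key id Function.injective_id
    rw [submatrix_id_id, submatrix_id_id, hN'.argDet_eq hνI, hPphases.argDet_eq hμI] at h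
    simp only [id] at h
    linarith

end Majorization

end TProduct

/-! ### The block-circulant embedding -/

namespace TProduct

open Matrix

section Bcirc

variable {n p : ℕ}

theorem bcirc_apply {m n p : ℕ} (A : Tensor m n p) (a : Fin p × Fin m) (b : Fin p × Fin n) :
    bcirc A a b = A a.2 b.2 (a.1 - b.1) := rfl

theorem bcirc_injective {m n p : ℕ} :
    Function.Injective (bcirc : Tensor m n p → Matrix (Fin p × Fin m) (Fin p × Fin n) ℂ) := by
  intro A B h
  funext i j k
  have : NeZero p := ⟨k.pos.ne'⟩
  simpa [bcirc_apply] using congrFun (congrFun h (k, i)) (0, j)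

theorem bcirc_tProd {m n s p : ℕ} (A : Tensor m n p) (B : Tensor n s p) :
    bcirc (tProd A B) = bcirc A * bcirc B := by
  ext ⟨k, i⟩ ⟨l, j⟩
  have : NeZero p := ⟨k.pos.ne'⟩
  simp only [bcirc_apply, tProd, fold, unfold, Matrix.mul_apply, Matrix.of_apply,
    Fintype.sum_prod_type]
  refine (Equiv.sum_comp (Equiv.subRight l) _).symm.trans (Finset.sum_congr rfl fun a _ => ?_)
  simp [sub_sub_sub_cancel_right]

theorem bcirc_tId : bcirc (tId n p) = 1 := by
  ext ⟨k, i⟩ ⟨l, j⟩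
  have : NeZero p := ⟨k.pos.ne'⟩
  have h : ((k - l : Fin p) : ℕ) = 0 ↔ k = l := by
    rw [← sub_eq_zero (a := k), Fin.ext_iff, Fin.val_zero]
  simp [bcirc_apply, tId, Matrix.one_apply, h, and_comm]

/-- `bcirc` as a real-linear map. -/
def bcircLinear (n p : ℕ) :
    Tensor n n p →ₗ[ℝ] Matrix (Fin p × Fin n) (Fin p × Fin n) ℂ where
  toFun := bcirc
  map_add' _ _ := rfl
  map_smul' _ _ := rfl

/-- The inverse of an invertible block-circulant matrix is block-circulant, because the T-inverse
solves a linear system with matrix `bcirc A`. -/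
theorem tInvertible_of_isUnit_bcirc {A : Tensor n n p} (hA : IsUnit (bcirc A)) :
    TInvertible A := by
  have hdet := (isUnit_iff_isUnit_det _).1 hA
  have h1 : tProd A (fold ((bcirc A)⁻¹ * unfold (tId n p))) = tId n p := by
    change fold (bcirc A * ((bcirc A)⁻¹ * unfold (tId n p))) = _
    rw [mul_nonsing_inv_cancel_left _ _ hdet]
    rfl
  refine ⟨_, h1, bcirc_injective ?_⟩
  have h2 := congrArg bcirc h1
  rw [bcirc_tProd, bcirc_tId] at h2 ⊢
  exact mul_eq_one_comm.1 h2

theorem bcirc_tInv {A : Tensor n n p} (hA : IsUnit (bcirc A)) :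
    bcirc (tInv A) = (bcirc A)⁻¹ := by
  have h := tInvertible_of_isUnit_bcirc hA
  rw [tInv, dif_pos h]
  have h1 := congrArg bcirc h.choose_spec.1
  rw [bcirc_tProd, bcirc_tId] at h1
  exact (inv_eq_right_inv h1).symm

theorem frobInner_tProd_self (A : Tensor n n p) (X : Tensor n 1 p) :
    frobInner X (tProd A X) =
      star (fun a : Fin p × Fin n => X a.2 0 a.1) ⬝ᵥ
        (bcirc A *ᵥ fun a : Fin p × Fin n => X a.2 0 a.1) := by
  simp only [frobInner, Finset.univ_unique, Finset.sum_singleton, Fin.default_eq_zero, dotProduct,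
    Fintype.sum_prod_type]
  rw [Finset.sum_comm]
  rfl

theorem mem_strictlyAccretive_iff {A : Tensor n n p} :
    A ∈ strictlyAccretive n p ↔ IsAccretive (bcirc A) := by
  constructor
  · intro h x hx
    have h1 := h (fun i _ k => x (k, i)) fun h0 => hx (funext fun a =>
      congrFun (congrFun (congrFun h0 a.2) 0) a.1)
    rwa [frobInner_tProd_self] at h1
  · intro h X hX
    rw [frobInner_tProd_self]
    refine h _ fun h0 => hX ?_
    funext i j k
    rw [Subsingleton.elim j 0]
    exact congrFun h0 (k, i)

theorem isSectorial_of_mem_strictlyAccretive {A : Tensor n n p} (hA : A ∈ strictlyAccretive n p) :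
    IsSectorial A := by
  rintro ⟨X, hX, h0⟩
  have hX0 : X ≠ 0 := by
    rintro rfl
    simp [frobNorm, frobInner] at hX
  simpa [h0] using hA X hX0

/-- `bcirc A` with rows and columns numbered from top to bottom and from left to right. -/
def bcircFin (A : Tensor n n p) : Matrix (Fin (p * n)) (Fin (p * n)) ℂ :=
  (bcirc A).submatrix finProdFinEquiv.symm finProdFinEquiv.symm

theorem hasPhases_bcircFin_iff {A : Tensor n n p} {φ : Fin (p * n) → ℝ} :
    HasPhases (bcircFin A) φ ↔ HasPhases (bcirc A) (φ ∘ finProdFinEquiv) := by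
  constructor <;> intro h
  · simpa [bcircFin] using h.submatrix_equiv finProdFinEquiv
  · have := h.submatrix_equiv finProdFinEquiv.symm
    rwa [Function.comp_assoc, Equiv.self_comp_symm, Function.comp_id] at this

theorem isAccretive_bcircFin {A : Tensor n n p} (hA : A ∈ strictlyAccretive n p) :
    IsAccretive (bcircFin A) :=
  (mem_strictlyAccretive_iff.1 hA).submatrix finProdFinEquiv.symm.injective

theorem isCanonicalPhase_iff {A : Tensor n n p} (hA : A ∈ strictlyAccretive n p)
    {φ : Fin (p * n) → ℝ} : IsCanonicalPhase A φ ↔ Antitone φ ∧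
      (∀ i, φ i ∈ Set.Ioo (-(Real.pi / 2)) (Real.pi / 2)) ∧ HasPhases (bcircFin A) φ := by
  constructor
  · intro h
    have h1 : HasPhases (bcircFin A) φ := hasPhases_bcircFin_iff.2 h.decomposition
    exact ⟨h.antitone, h1.mem_Ioo (isAccretive_bcircFin hA) h.mem_Ioc, h1⟩
  · rintro ⟨h1, h2, h3⟩
    refine ⟨fun k => ⟨?_, ?_⟩, h1, fun k l => ?_, hasPhases_bcircFin_iff.1 h3⟩
    · linarith [(h2 k).1, Real.pi_pos]
    · linarith [(h2 k).2, Real.pi_pos]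
    · linarith [(h2 k).2, (h2 l).1]

theorem existsUnique_isCanonicalPhase {A : Tensor n n p} (hA : A ∈ strictlyAccretive n p) :
    ∃! φ, IsCanonicalPhase A φ := by
  simp only [isCanonicalPhase_iff hA]
  obtain ⟨φ, h1, h2, h3⟩ := (isAccretive_bcircFin hA).exists_antitone_hasPhases
  exact ⟨φ, ⟨h1, h2, h3⟩, fun ψ hψ => hψ.2.2.eq_of_antitone h3 hψ.1 h1 hψ.2.1 h2⟩

theorem isCanonicalPhase_canonicalPhase {A : Tensor n n p} (hA : A ∈ strictlyAccretive n p) :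
    IsCanonicalPhase A (canonicalPhase A) :=
  Classical.epsilon_spec (existsUnique_isCanonicalPhase hA).exists

end Bcirc

/-! ### Majorization of nonincreasing vectors -/

theorem decreasingRearrangement_of_antitone {N : ℕ} {x : Fin N → ℝ} (hx : Antitone x) :
    decreasingRearrangement x = x := by
  rw [decreasingRearrangement, Tuple.sort_eq_refl_iff_monotone.2 (show Monotone (-x) from hx.neg)]
  rfl

theorem sum_filter_val_lt {N k : ℕ} (hk : k ≤ N) (x : Fin N → ℝ) :
    ∑ i : Fin N with i.val < k, x i = ∑ j : Fin k, x (Fin.castLE hk j) := by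
  symm
  refine Finset.sum_bij (fun j _ => Fin.castLE hk j) (fun j _ => by simp)
    (fun a _ b _ h => Fin.castLE_injective hk h) (fun i hi => ?_) fun _ _ => rfl
  exact ⟨⟨i, (Finset.mem_filter.1 hi).2⟩, Finset.mem_univ _, rfl⟩

theorem majorized_of_antitone {N : ℕ} {x y : Fin N → ℝ} (hx : Antitone x) (hy : Antitone y)
    (hle : ∀ k, ∀ hk : k ≤ N, ∑ j, x (Fin.castLE hk j) ≤ ∑ j, y (Fin.castLE hk j))
    (hsum : ∑ i, x i = ∑ i, y i) : Majorized x y := by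
  refine ⟨fun k hk => ?_, hsum⟩
  rw [decreasingRearrangement_of_antitone hx, decreasingRearrangement_of_antitone hy,
    sum_filter_val_lt hk, sum_filter_val_lt hk]
  exact hle k hk

end TProduct

/-! ### The geometric mean -/

namespace TProduct

open Matrix MeasureTheory Set

theorem image_tan_Ioo_zero_pi_div_two : Real.tan '' Ioo 0 (Real.pi / 2) = Ioi 0 := by
  ext t
  constructor
  · rintro ⟨θ, hθ, rfl⟩
    exact Real.tan_pos_of_pos_of_lt_pi_div_two hθ.1 hθ.2
  · intro ht
    exact ⟨Real.arctan t, ⟨Real.arctan_pos.2 ht, Real.arctan_lt_pi_div_two t⟩, Real.tan_arctan t⟩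

theorem isAccretive_sin_sq_add_cos_sq {ι : Type*} [Fintype ι] {M N : Matrix ι ι ℂ}
    (hM : IsAccretive M) (hN : IsAccretive N) (θ : ℝ) :
    IsAccretive ((Real.sin θ ^ 2) • M + (Real.cos θ ^ 2) • N) :=
  convex_isAccretive hM hN (sq_nonneg _) (sq_nonneg _) (Real.sin_sq_add_cos_sq θ)

section MatrixMean

variable {ι : Type*} [Fintype ι] [DecidableEq ι] {M N : Matrix ι ι ℂ}

theorem isUnit_one_add_smul_inv_mul_sub_one (hM : IsAccretive M) (hN : IsAccretive N) :
    ∀ c ∈ Icc (0 : ℝ) 1, IsUnit (1 + c • (M⁻¹ * N - 1)) := by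
  intro c hc
  have hdet := (isUnit_iff_isUnit_det _).1 hM.isUnit
  have h : 1 + c • (M⁻¹ * N - 1) = M⁻¹ * ((1 - c) • M + c • N) := by
    rw [Matrix.mul_add, Matrix.mul_smul, Matrix.mul_smul, nonsing_inv_mul _ hdet]
    module
  rw [h]
  exact ((isUnit_nonsing_inv_iff).2 hM.isUnit).mul
    (convex_isAccretive hM hN (sub_nonneg.2 hc.2) hc.1 (by ring)).isUnit

theorem inv_sin_sq_add_cos_sq (hM : IsAccretive M) (θ : ℝ) :
    ((Real.sin θ ^ 2) • M + (Real.cos θ ^ 2) • N)⁻¹ =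
      Ring.inverse (1 + (1 * Real.cos θ ^ 2) • (M⁻¹ * N - 1)) * M⁻¹ := by
  have hdet := (isUnit_iff_isUnit_det _).1 hM.isUnit
  rw [← nonsing_inv_eq_ringInverse, ← Matrix.mul_inv_rev]
  congr 1
  rw [Matrix.mul_add, Matrix.mul_smul, Matrix.mul_sub, mul_nonsing_inv_cancel_left _ _ hdet,
    Matrix.mul_one, one_mul, Real.sin_sq]
  module

theorem inv_real_smul (A : Matrix ι ι ℂ) {c : ℝ} (hc : c ≠ 0) : (c • A)⁻¹ = c⁻¹ • A⁻¹ := by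
  by_cases hA : IsUnit A
  · have hdet := (isUnit_iff_isUnit_det _).1 hA
    refine inv_eq_left_inv ?_
    rw [smul_mul_smul_comm, inv_mul_cancel₀ hc, one_smul, nonsing_inv_mul _ hdet]
  · have hcA : ¬IsUnit (c • A) := fun h => hA <| by
      exact (isUnit_smul_iff (Units.mk0 c hc) A).1 h
    rw [isUnit_iff_isUnit_det] at hA hcA
    rw [nonsing_inv_apply_not_isUnit _ hA, nonsing_inv_apply_not_isUnit _ hcA, smul_zero]

/-- The substitution `t = tan θ`. -/
theorem inv_cos_sq_smul_integrand {θ : ℝ} (hθ : θ ∈ Ioo 0 (Real.pi / 2))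
    (M N : Matrix ι ι ℂ) :
    |1 / Real.cos θ ^ 2| • ((Real.tan θ)⁻¹ • (Real.tan θ • M + (Real.tan θ)⁻¹ • N)⁻¹) =
      ((Real.sin θ ^ 2) • M + (Real.cos θ ^ 2) • N)⁻¹ := by
  have hs := Real.sin_pos_of_pos_of_lt_pi hθ.1 (by linarith [hθ.2, Real.pi_pos])
  have hc := Real.cos_pos_of_mem_Ioo ⟨by linarith [hθ.1, Real.pi_pos], hθ.2⟩
  have h : (Real.sin θ ^ 2) • M + (Real.cos θ ^ 2) • N =
      (Real.sin θ * Real.cos θ) • (Real.tan θ • M + (Real.tan θ)⁻¹ • N) := by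
    rw [Real.tan_eq_sin_div_cos, smul_add, smul_smul, smul_smul]
    congr 2 <;> field_simp
  rw [h, inv_real_smul _ (mul_pos hs hc).ne', smul_smul, abs_of_nonneg (by positivity),
    Real.tan_eq_sin_div_cos]
  congr 1
  field_simp

open scoped Matrix.Norms.Operator

theorem continuous_inv_sin_sq_add_cos_sq (hM : IsAccretive M) (hN : IsAccretive N) :
    Continuous fun θ : ℝ => ((Real.sin θ ^ 2) • M + (Real.cos θ ^ 2) • N)⁻¹ := by
  simp only [inv_sin_sq_add_cos_sq hM]
  exact (continuous_invSqrt_integrand (isUnit_one_add_smul_inv_mul_sub_one hM hN)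
    ⟨zero_le_one, le_rfl⟩).mul continuous_const

/-- The inverse of the geometric mean of `M` and `N`, in the form
`(2/π) ∫₀^{π/2} (sin²θ M + cos²θ N)⁻¹ dθ`. -/
noncomputable def meanInv (M N : Matrix ι ι ℂ) : Matrix ι ι ℂ :=
  (2 / Real.pi) • ∫ θ in (0 : ℝ)..Real.pi / 2, ((Real.sin θ ^ 2) • M + (Real.cos θ ^ 2) • N)⁻¹

theorem meanInv_eq_invSqrtIntegral_mul (hM : IsAccretive M) (hN : IsAccretive N) :
    meanInv M N = invSqrtIntegral (M⁻¹ * N - 1) 1 * M⁻¹ := by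
  rw [meanInv, invSqrtIntegral, smul_mul_assoc]
  congr 1
  simp only [inv_sin_sq_add_cos_sq hM]
  exact ((ContinuousLinearMap.mul ℝ (Matrix ι ι ℂ)).flip M⁻¹).intervalIntegral_comp_comm
    ((continuous_invSqrt_integrand (isUnit_one_add_smul_inv_mul_sub_one hM hN)
      ⟨zero_le_one, le_rfl⟩).intervalIntegrable _ _)

/-- `meanInv M N = (M⁻¹N)^{-1/2} M⁻¹`, so it solves the Riccati equation `J N J = M⁻¹`. -/
theorem meanInv_mul_mul_meanInv (hM : IsAccretive M) (hN : IsAccretive N) :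
    meanInv M N * N * meanInv M N = M⁻¹ := by
  have hE := isUnit_one_add_smul_inv_mul_sub_one hM hN
  have h1 : (1 : ℝ) ∈ Icc (0 : ℝ) 1 := ⟨zero_le_one, le_rfl⟩
  have hsq := invSqrtIntegral_sq hE h1
  have hcomm := commute_invSqrtIntegral hE h1 (commute_ringInverse_one_add_smul (M⁻¹ * N - 1))
  rw [meanInv_eq_invSqrtIntegral_mul hM hN]
  generalize invSqrtIntegral (M⁻¹ * N - 1) 1 = R at hsq hcomm ⊢
  have hZ : (M⁻¹ * N) * R = R * (M⁻¹ * N) := by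
    have := hcomm.eq
    rw [sub_mul, mul_sub, one_mul, mul_one] at this
    exact sub_left_injective this
  rw [one_smul, add_sub_cancel] at hsq
  calc R * M⁻¹ * N * (R * M⁻¹) = R * ((M⁻¹ * N) * R) * M⁻¹ := by simp only [mul_assoc]
    _ = R * R * (M⁻¹ * N) * M⁻¹ := by rw [hZ]; simp only [mul_assoc]
    _ = M⁻¹ := by rw [hsq, one_mul]

theorem isAccretive_meanInv (hM : IsAccretive M) (hN : IsAccretive N) :
    IsAccretive (meanInv M N) := by
  refine IsAccretive.smul (fun x hx => ?_) (div_pos two_pos Real.pi_pos)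
  let l : Matrix ι ι ℂ →ₗ[ℝ] ℝ :=
    { toFun := fun A => (star x ⬝ᵥ (A *ᵥ x)).re
      map_add' := fun A B => by rw [add_mulVec, dotProduct_add, Complex.add_re]
      map_smul' := fun c A => by
        rw [smul_mulVec, dotProduct_smul, Complex.smul_re]
        rfl }
  have hcont := continuous_inv_sin_sq_add_cos_sq hM hN
  have h := l.toContinuousLinearMap.intervalIntegral_comp_comm
    (hcont.intervalIntegrable (μ := volume) 0 (Real.pi / 2))
  refine lt_of_lt_of_eq ?_ h
  refine intervalIntegral.intervalIntegral_pos_of_pos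
    (Continuous.intervalIntegrable (by fun_prop) _ _) (fun θ => ?_) (by positivity)
  exact (isAccretive_sin_sq_add_cos_sq hM hN θ).inv x hx

end MatrixMean

section TensorMean

variable {n p : ℕ} {A B : Tensor n n p}

theorem isUnit_bcirc_smul_add (hA : IsAccretive (bcirc A)) (hB : IsAccretive (bcirc B)) {t : ℝ}
    (ht : 0 < t) : IsUnit (bcirc (t • A + t⁻¹ • B)) :=
  ((hA.smul ht).add (hB.smul (inv_pos.2 ht))).isUnit

theorem bcirc_geomMeanIntegrand (hA : IsAccretive (bcirc A)) (hB : IsAccretive (bcirc B)) {t : ℝ}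
    (ht : 0 < t) : bcirc (geomMeanIntegrand A B t) =
      t⁻¹ • (t • bcirc A + t⁻¹ • bcirc B)⁻¹ :=
  congrArg (t⁻¹ • ·) (bcirc_tInv (isUnit_bcirc_smul_add hA hB ht))

open scoped Matrix.Norms.Operator

theorem bcirc_tInv_sin_sq_add_cos_sq (hA : IsAccretive (bcirc A)) (hB : IsAccretive (bcirc B))
    (θ : ℝ) : bcirc (tInv ((Real.sin θ ^ 2) • A + (Real.cos θ ^ 2) • B)) =
      ((Real.sin θ ^ 2) • bcirc A + (Real.cos θ ^ 2) • bcirc B)⁻¹ :=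
  bcirc_tInv (isAccretive_sin_sq_add_cos_sq hA hB θ).isUnit

theorem continuous_tInv_sin_sq_add_cos_sq (hA : IsAccretive (bcirc A))
    (hB : IsAccretive (bcirc B)) :
    Continuous fun θ : ℝ => tInv ((Real.sin θ ^ 2) • A + (Real.cos θ ^ 2) • B) := by
  obtain ⟨l, hl⟩ := (bcircLinear n p).exists_leftInverse_of_injective
    (LinearMap.ker_eq_bot.2 bcirc_injective)
  have h := l.continuous_of_finiteDimensional.comp (continuous_inv_sin_sq_add_cos_sq hA hB)
  convert! h using 1
  funext θ
  exact (LinearMap.congr_fun hl _).symm.trans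
    (congrArg l (bcirc_tInv_sin_sq_add_cos_sq hA hB θ))

/-- The substitution `t = tan θ` turns the integral over `(0, ∞)` into an integral of a continuous
function over a compact interval. -/
theorem integrableOn_geomMeanIntegrand_and_integral_eq (hA : IsAccretive (bcirc A))
    (hB : IsAccretive (bcirc B)) : IntegrableOn (geomMeanIntegrand A B) (Ioi 0) ∧
      ∫ t in Ioi (0 : ℝ), geomMeanIntegrand A B t =
        ∫ θ in (0 : ℝ)..Real.pi / 2, tInv ((Real.sin θ ^ 2) • A + (Real.cos θ ^ 2) • B) := by
  have hderiv : ∀ θ ∈ Ioo 0 (Real.pi / 2),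
      HasDerivWithinAt Real.tan (1 / Real.cos θ ^ 2) (Ioo 0 (Real.pi / 2)) θ := fun θ hθ =>
    (Real.hasDerivAt_tan_of_mem_Ioo
      ⟨by linarith [hθ.1, Real.pi_pos], hθ.2⟩).hasDerivWithinAt
  have hinj : InjOn Real.tan (Ioo 0 (Real.pi / 2)) := Real.injOn_tan.mono
    (Ioo_subset_Ioo_left (by linarith [Real.pi_pos]))
  have hcont := continuous_tInv_sin_sq_add_cos_sq hA hB
  have hcongr : EqOn (fun θ => |1 / Real.cos θ ^ 2| • geomMeanIntegrand A B (Real.tan θ))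
      (fun θ => tInv ((Real.sin θ ^ 2) • A + (Real.cos θ ^ 2) • B)) (Ioo 0 (Real.pi / 2)) := by
    intro θ hθ
    refine bcirc_injective ?_
    have htan := Real.tan_pos_of_pos_of_lt_pi_div_two hθ.1 hθ.2
    rw [bcirc_tInv_sin_sq_add_cos_sq hA hB, ← inv_cos_sq_smul_integrand hθ,
      ← bcirc_geomMeanIntegrand hA hB htan]
    rfl
  rw [← image_tan_Ioo_zero_pi_div_two]
  constructor
  · rw [integrableOn_image_iff_integrableOn_abs_deriv_smul measurableSet_Ioo hderiv hinj,
      integrableOn_congr_fun hcongr measurableSet_Ioo]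
    exact hcont.continuousOn.integrableOn_Icc.mono_set Ioo_subset_Icc_self
  · rw [integral_image_eq_integral_abs_deriv_smul measurableSet_Ioo hderiv hinj,
      setIntegral_congr_fun measurableSet_Ioo hcongr,
      intervalIntegral.integral_of_le (by positivity), integral_Ioc_eq_integral_Ioo]

theorem bcirc_geomMeanInv (hA : IsAccretive (bcirc A)) (hB : IsAccretive (bcirc B)) :
    bcirc (geomMeanInv A B) = meanInv (bcirc A) (bcirc B) := by
  rw [geomMeanInv, (integrableOn_geomMeanIntegrand_and_integral_eq hA hB).2]
  have h := (bcircLinear n p).toContinuousLinearMap.intervalIntegral_comp_comm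
    ((continuous_tInv_sin_sq_add_cos_sq hA hB).intervalIntegrable (μ := volume) 0 (Real.pi / 2))
  refine (congrArg ((2 / Real.pi) • ·) h.symm).trans (congrArg ((2 / Real.pi) • ·) ?_)
  exact intervalIntegral.integral_congr fun θ _ => bcirc_tInv_sin_sq_add_cos_sq hA hB θ

theorem bcirc_geomMean (hA : IsAccretive (bcirc A)) (hB : IsAccretive (bcirc B)) :
    bcirc (geomMean A B) = (meanInv (bcirc A) (bcirc B))⁻¹ := by
  rw [geomMean, bcirc_tInv, bcirc_geomMeanInv hA hB]
  rw [bcirc_geomMeanInv hA hB]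
  exact (isAccretive_meanInv hA hB).isUnit

theorem geomMean_mem_strictlyAccretive (hA : A ∈ strictlyAccretive n p)
    (hB : B ∈ strictlyAccretive n p) : geomMean A B ∈ strictlyAccretive n p := by
  rw [mem_strictlyAccretive_iff] at *
  rw [bcirc_geomMean hA hB]
  exact (isAccretive_meanInv hA hB).inv

theorem bcircFin_geomMean_riccati (hA : IsAccretive (bcirc A)) (hB : IsAccretive (bcirc B)) :
    bcircFin (geomMean A B) * (bcircFin A)⁻¹ * bcircFin (geomMean A B) = bcircFin B := by
  have hJ := (isUnit_iff_isUnit_det _).1 (isAccretive_meanInv hA hB).isUnit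
  have h : bcirc (geomMean A B) * (bcirc A)⁻¹ * bcirc (geomMean A B) = bcirc B := by
    rw [bcirc_geomMean hA hB, ← meanInv_mul_mul_meanInv hA hB]
    generalize meanInv (bcirc A) (bcirc B) = J at hJ
    rw [mul_assoc J, nonsing_inv_mul_cancel_left _ _ hJ, mul_assoc, mul_nonsing_inv _ hJ, mul_one]
  simp only [bcircFin]
  rw [inv_submatrix_equiv, submatrix_mul_equiv, submatrix_mul_equiv, h]

end TensorMean

end TProduct

theorem mainTheorem1 (n p : ℕ) (A B : TProduct.Tensor n n p)
    (hA : A ∈ TProduct.strictlyAccretive n p) (hB : B ∈ TProduct.strictlyAccretive n p) :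
    -- the geometric mean `A # B` is well defined
    ((∀ t : ℝ, 0 < t → TProduct.TInvertible (t • A + t⁻¹ • B)) ∧
      MeasureTheory.IntegrableOn (TProduct.geomMeanIntegrand A B) (Set.Ioi 0) ∧
      TProduct.TInvertible (TProduct.geomMeanInv A B)) ∧
    -- `A`, `B` and `A # B` are sectorial and have exactly one canonical T-phase vector each
    ((TProduct.IsSectorial A ∧ ∃! φ, TProduct.IsCanonicalPhase A φ) ∧
      (TProduct.IsSectorial B ∧ ∃! φ, TProduct.IsCanonicalPhase B φ) ∧
      (TProduct.IsSectorial (TProduct.geomMean A B) ∧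
        ∃! φ, TProduct.IsCanonicalPhase (TProduct.geomMean A B) φ)) ∧
    -- the majorization
    TProduct.Majorized (TProduct.canonicalPhase (TProduct.geomMean A B))
      ((1 / 2 : ℝ) • TProduct.canonicalPhase A + (1 / 2 : ℝ) • TProduct.canonicalPhase B) := by
  have hA' := TProduct.mem_strictlyAccretive_iff.1 hA
  have hB' := TProduct.mem_strictlyAccretive_iff.1 hB
  have hG := TProduct.geomMean_mem_strictlyAccretive hA hB
  refine ⟨⟨fun t ht => TProduct.tInvertible_of_isUnit_bcirc
      (TProduct.isUnit_bcirc_smul_add hA' hB' ht),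
    (TProduct.integrableOn_geomMeanIntegrand_and_integral_eq hA' hB').1, TProduct.tInvertible_of_isUnit_bcirc ?_⟩,
    ⟨⟨TProduct.isSectorial_of_mem_strictlyAccretive hA,
        TProduct.existsUnique_isCanonicalPhase hA⟩,
      ⟨TProduct.isSectorial_of_mem_strictlyAccretive hB,
        TProduct.existsUnique_isCanonicalPhase hB⟩,
      TProduct.isSectorial_of_mem_strictlyAccretive hG,
        TProduct.existsUnique_isCanonicalPhase hG⟩, ?_⟩
  · rw [TProduct.bcirc_geomMeanInv hA' hB']
    exact (TProduct.isAccretive_meanInv hA' hB').isUnit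
  · obtain ⟨hα, hαI, hαP⟩ := (TProduct.isCanonicalPhase_iff hA).1
      (TProduct.isCanonicalPhase_canonicalPhase hA)
    obtain ⟨hβ, hβI, hβP⟩ := (TProduct.isCanonicalPhase_iff hB).1
      (TProduct.isCanonicalPhase_canonicalPhase hB)
    obtain ⟨hγ, hγI, hγP⟩ := (TProduct.isCanonicalPhase_iff hG).1
      (TProduct.isCanonicalPhase_canonicalPhase hG)
    obtain ⟨hle, hsum⟩ := TProduct.two_mul_sum_phases_le hαP hβP hγP hα hβ hαI hβI hγI
      (TProduct.bcircFin_geomMean_riccati hA' hB')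
    refine TProduct.majorized_of_antitone hγ (fun i j hij => ?_) (fun k hk => ?_) ?_
    · simp only [Pi.add_apply, Pi.smul_apply, smul_eq_mul]
      linarith [hα hij, hβ hij]
    all_goals
      simp only [Pi.add_apply, Pi.smul_apply, smul_eq_mul, Finset.sum_add_distrib,
        ← Finset.mul_sum]
    · linarith [hle k hk]
    · linarith
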